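/- Let $M\ge 2$, $K,N\ge 1$ be integers. For a family $\mathcal C=\{\mathbf C^0,\dots,\mathbf C^{K-1}\}$ of $M\times N$ matrices whose entries are complex roots of unity, put $\rho_{\mathbf C^\mu,\mathbf C^\nu}(\tau)=\sum_{m=0}^{M-1}\sum_{t=0}^{N-1-\tau}c^\mu_{m,t}\overline{c^\nu_{m,t+\tau}}$ for $0\le\tau\le N-1$, and let $\delta_{\max}=\delta_{\max}(\mathcal C)$ be the maximum of $|\rho_{\mathbf C^\mu,\mathbf C^\nu}(\tau)|$ over all $\mu,\nu$ and $0\le\tau\le N-1$ with $(\mu\ne\nu$ or $\tau\neq 0)$. The Welch bound is $$\delta_{\max}^2\ge W_{M,N,K}:=M^2N^2\,\frac{K/M-1}{K(2N-1)-1},$$ and the generalized Levenshtein bound (GLB) with weight vector $\mathbf w=(w_0,\dots,w_{2N-2})$, $w_i\ge 0$, $\sum w_i=1$, is $$\delta_{\max}^2\ge \mathrm{GLB}_{M,N,K}(\mathbf w):=M\left[N-\frac{Q(\mathbf w,N(MN-1)/K)}{1-\frac1K\sum_i w_i^2}\right],\qquad Q(\mathbf w,a)=a\sum_{i}w_i^2+\sum_{s,t}\min\{|t-s|,2N-1-|t-s|\}\,w_sw_t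 .$$ For $2\le m\le 2N-1$ let $\mathbf w^{(m)}$ be the "positive-cycle-of-sine" weight vector $w_i=\tan\frac{\pi}{2m}\sin\frac{\pi i}{m}$ for $0\le i\le m-1$, $w_i=0$ for $m\le i\le 2N-2$. Let $\overline K=\overline K_{M,N}=\left\lfloor 4(MN-1)N\sin^2\frac{\pi}{2(2N-1)}\right\rfloor$ and, for $0<r<2$, $$f(r)=\begin{cases} r/4, & 0<r\le 1,\\ \frac{4-3r}{4}+\frac{r-1}{2}\cos\frac{\pi}{r}+\frac{3r}{2\pi}\sin\frac{\pi}{r}, & 1<r<2,\end{cases}\qquad B_{M,K}=1-\inf_{0<r<2}\left(\frac{M\pi^2}{8Kr}+f(r)\right).$$ Then: (1) If $m=m(N)$ satisfies $m/N\to r\in(0,2)$, then $Q(\mathbf w^{(m)},0)/N\to f(r)$ as $N\to\infty$. (2) For every fixed $K\ge2$, $\max_{2\le m\le 2N-1}\mathrm{GLB}_{M,N,K}(\mathbf w^{(m)})/(MN)\to B_{M,K}$ as $N\to\infty$. Consequently $\delta_{\max}^2\gtrsim MN\,B_{M,K}$, that is, for every fixed $K\ge1$ and every $\varepsilon>0$,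 for all sufficiently large $N$ every family $\mathcal C$ as above satisfies $\delta_{\max}^2\ge MN(B_{M,K}-\varepsilon)$. If $K\ge\overline K+1$ for all large $N$, the infimum in $B_{M,K}$ is attained at some $r\in(0,2)$. (3) This asymptotic lower bound is tighter than the Welch bound for all $K\ge\overline K+1$ if and only if $$M\in\{2,3,4,5,6,7,8,9,10,11,12,13,14,15,16,18,20,22,24,26,28,30,31,33,35,37,39,41,43,45,60\}.$$ Here the left-hand side may be read in either of two ways, and the equivalence holds for both: (a) for each fixed $K$ such that $K\ge\overline K_{M,N}+1$ for all large $N$, one has $W_{M,N,K}<MN\,B_{M,K}$ for all sufficiently large $N$; (b) for all sufficiently large $N$, the inequality $W_{M,N,K}<MN\,B_{M,K}$ holds for all $K\ge\overline K_{M,N}+1$. -/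

import Mathlib

open Filter Topology

noncomputable section

namespace QCSS

/-- Aperiodic correlation function of two complex sequences of length `N` at time-shift `τ`:
the sum of `a_s * conj (b_t)` over all positions with `t = s + τ`
(so `t` runs over `0 ≤ s`, `s + τ ≤ N - 1`, and the sum is empty for `|τ| ≥ N`). -/
def aperiodicCorr {N : ℕ} (a b : Fin N → ℂ) (τ : ℤ) : ℂ :=
  ∑ s : Fin N, ∑ t : Fin N,
    if ((t : ℕ) : ℤ) = ((s : ℕ) : ℤ) + τ then a s * (starRingEnd ℂ) (b t) else 0

/-- Aperiodic correlation sum of two `M × N` matrices: the sum over the `M` rows (channels). -/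
def corrSum {M N : ℕ} (A B : Matrix (Fin M) (Fin N) ℂ) (τ : ℤ) : ℂ :=
  ∑ m : Fin M, aperiodicCorr (A m) (B m) τ

/-- Aperiodic auto-correlation tolerance (maximum over a finite set; `0` if that set is empty). -/
def deltaAuto {K M N : ℕ} (C : Fin K → Matrix (Fin M) (Fin N) ℂ) : ℝ :=
  sSup {x : ℝ | ∃ (μ : Fin K) (τ : ℕ), 0 < τ ∧ τ < N ∧ x = ‖corrSum (C μ) (C μ) (τ : ℤ)‖}

/-- Aperiodic cross-correlation tolerance (maximum over a finite set; `0` if that set is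
empty). -/
def deltaCross {K M N : ℕ} (C : Fin K → Matrix (Fin M) (Fin N) ℂ) : ℝ :=
  sSup {x : ℝ | ∃ (μ ν : Fin K) (τ : ℕ), μ ≠ ν ∧ τ < N ∧ x = ‖corrSum (C μ) (C ν) (τ : ℤ)‖}

/-- Aperiodic tolerance (maximum aperiodic correlation magnitude) of the family `C`. -/
def deltaMax {K M N : ℕ} (C : Fin K → Matrix (Fin M) (Fin N) ℂ) : ℝ :=
  max (deltaAuto C) (deltaCross C)

/-- All entries of all matrices are complex roots of unity (of some common order `q`). -/
def OverRootsOfUnity {K M N : ℕ} (C : Fin K → Matrix (Fin M) (Fin N) ℂ) : Prop :=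
  ∃ q : ℕ, 0 < q ∧ ∀ (ν : Fin K) (m : Fin M) (n : Fin N), C ν m n ^ q = 1

/-- The Welch lower bound on the square of the aperiodic tolerance. -/
def welchBound (M N K : ℕ) : ℝ :=
  (M : ℝ) ^ 2 * (N : ℝ) ^ 2 * (((K : ℝ) / M - 1) / (K * (2 * (N : ℝ) - 1) - 1))

/-- The cyclic distance `min (|t - s|) (2N - 1 - |t - s|)`. -/
def cyclicDist (N s t : ℕ) : ℝ :=
  min |(t : ℝ) - s| (2 * (N : ℝ) - 1 - |(t : ℝ) - s|)

/-- The quadratic form `Q(w, a)` of a weight vector `w_0, …, w_{2N-2}`. -/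
def quadForm (N : ℕ) (w : ℕ → ℝ) (a : ℝ) : ℝ :=
  a * ∑ i ∈ Finset.range (2 * N - 1), w i ^ 2 +
    ∑ s ∈ Finset.range (2 * N - 1), ∑ t ∈ Finset.range (2 * N - 1), cyclicDist N s t * w s * w t

/-- The generalized Levenshtein bound (GLB) with weight vector `w`. -/
def glb (M N K : ℕ) (w : ℕ → ℝ) : ℝ :=
  M * (N - quadForm N w ((N : ℝ) * ((M : ℝ) * N - 1) / K) /
    (1 - 1 / (K : ℝ) * ∑ i ∈ Finset.range (2 * N - 1), w i ^ 2))

/-- The "positive-cycle-of-sine" weight vector with parameter `m`. -/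
def sineWeight (m i : ℕ) : ℝ :=
  if i < m then Real.tan (Real.pi / (2 * m)) * Real.sin (Real.pi * i / m) else 0

/-- The best GLB obtained from the "positive-cycle-of-sine" weight vectors:
the maximum over `2 ≤ m ≤ 2N - 1`. -/
def sineGLB (M N K : ℕ) : ℝ :=
  sSup ((fun m : ℕ => glb M N K (sineWeight m)) '' Set.Icc 2 (2 * N - 1))

/-- The number `⌊4(MN - 1) N sin²(π / (2(2N - 1)))⌋`. -/
def Kbar (M N : ℕ) : ℕ :=
  ⌊4 * ((M : ℝ) * N - 1) * N * Real.sin (Real.pi / (2 * (2 * (N : ℝ) - 1))) ^ 2⌋₊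

/-- The piecewise function `f(r)`, `0 < r < 2`. -/
def limitQ (r : ℝ) : ℝ :=
  if r ≤ 1 then r / 4
  else (4 - 3 * r) / 4 + (r - 1) / 2 * Real.cos (Real.pi / r)
    + 3 * r / (2 * Real.pi) * Real.sin (Real.pi / r)

/-- The function `Mπ² / (8Kr) + f(r)`. -/
def limitLoss (M K : ℕ) (r : ℝ) : ℝ :=
  (M : ℝ) * Real.pi ^ 2 / (8 * (K : ℝ) * r) + limitQ r

/-- The factor `1 - inf_{0<r<2} (Mπ² / (8Kr) + f(r))`. -/
def limitFactor (M K : ℕ) : ℝ :=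
  1 - sInf (limitLoss M K '' Set.Ioo 0 2)

/-- The explicit finite set of numbers of channels. -/
def goodM : Finset ℕ :=
  {2, 3, 4, 5, 6, 7, 8, 9, 10, 11, 12, 13, 14, 15, 16, 18, 20, 22, 24, 26, 28, 30, 31, 33, 35,
    37, 39, 41, 43, 45, 60}

end QCSS

end

/-!
**The Levenshtein bound.** Pad the matrices by zeros to row length `2N - 1` and take all cyclic
shifts. Inner products of two such vectors are aperiodic correlation sums, so the sum of their
squared moduli, weighted by `w_s w_t`, is bounded above in terms of `δ_max`. The same sum is the
squared Frobenius norm of the weighted covariance matrix, whose diagonal is known exactly because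
the entries are unimodular; this bounds it below by window overlaps `N - cyclicDist`. Comparing the
two gives `glb_le_deltaMax_sq` for every probability weight vector.

**The limits.** The autocorrelation of the sampled sine has a closed form, so `Q(w⁽ᵐ⁾, 0) / N` is a
Riemann sum for `(π² / 4) ∫₀¹ min (ρu) (2 - ρu) ((1 - u) cos πu + sin πu / π) du` with `ρ = m / N`.
The integral is `limitQ ρ`, and the error is bounded by a null sequence in `m` alone
(`abs_quadForm_sineWeight_sub_le`). The limit of the optimized bound follows: `m = ⌊r N⌋` attains
the loss at `r` in the limit, and the uniform error excludes anything better, small `m` being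
useless.

**The comparison.** Put `x = M / K`. The normalized Welch bound decreases to `(1 - x) / 2`, so it is
beaten for large `N` exactly when `x π² / (8r) + f(r) < 1 / 2 + x / 2` for some `r` in `(0, 2)`. For
fixed `r` the difference of the two sides increases with `x`, so there is a threshold for `x`. It
lies between `60 / 149` and `29 / 72`: the inequality holds at the former for a suitable `r`
(`exists_lossGap_neg`) and fails at the latter for all `r` (`lossGap_nonneg`). Since `Kbar` is
governed by its limit `M π² / 4`, the numbers `M` for which all admissible `K` have
`M / K ≤ 60 / 149` are those of the list, and for every other `M` the number `K = ⌊72 M / 29⌋` is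
admissible with `M / K ≥ 29 / 72`.
-/

namespace QCSS

/-! ### The generalized Levenshtein bound -/

/-- The sum of the squared moduli of the entries of the Gram matrix of the vectors `x p`, the entry
`(p, q)` with weight `w p * w q`, equals the squared Frobenius norm of `∑ p, w p • x p (x p)ᴴ`;
discarding the off-diagonal entries of the latter bounds it from below. -/
theorem sum_sq_diag_le {P I : Type*} [Fintype P] [Fintype I] (w : P → ℝ) (x : P → I → ℂ) :
    ∑ i, (∑ p, w p * ‖x p i‖ ^ 2) ^ 2 ≤
      ∑ p, ∑ q, w p * w q * ‖∑ i, x p i * (starRingEnd ℂ) (x q i)‖ ^ 2 := by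
  have key : ∑ p, ∑ q, w p * w q * ‖∑ i, x p i * (starRingEnd ℂ) (x q i)‖ ^ 2 =
      ∑ i, ∑ j, ‖∑ p, (w p : ℂ) * (x p i * (starRingEnd ℂ) (x p j))‖ ^ 2 := by
    apply Complex.ofReal_injective
    push_cast
    simp_rw [← Complex.mul_conj', map_sum, map_mul, Complex.conj_conj, Complex.conj_ofReal,
      Finset.sum_mul_sum, Finset.mul_sum]
    have hL : ∀ p q, ∑ i, ∑ j, (w p : ℂ) * (w q : ℂ) * (x p i * (starRingEnd ℂ) (x q i) *
        ((starRingEnd ℂ) (x p j) * x q j)) = ∑ i, ∑ j, (w p : ℂ) *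
        (x p i * (starRingEnd ℂ) (x p j)) * ((w q : ℂ) * ((starRingEnd ℂ) (x q i) * x q j)) := by
      intro p q
      refine Finset.sum_congr rfl fun i _ => Finset.sum_congr rfl fun j _ => by ring
    simp_rw [hL]
    calc _ = ∑ p, ∑ i, ∑ q, ∑ j, (w p : ℂ) *
        (x p i * (starRingEnd ℂ) (x p j)) * ((w q : ℂ) * ((starRingEnd ℂ) (x q i) * x q j)) :=
          Finset.sum_congr rfl fun p _ => Finset.sum_comm
      _ = ∑ i, ∑ p, ∑ q, ∑ j, (w p : ℂ) *
        (x p i * (starRingEnd ℂ) (x p j)) * ((w q : ℂ) * ((starRingEnd ℂ) (x q i) * x q j)) :=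
          Finset.sum_comm
      _ = ∑ i, ∑ p, ∑ j, ∑ q, (w p : ℂ) *
        (x p i * (starRingEnd ℂ) (x p j)) * ((w q : ℂ) * ((starRingEnd ℂ) (x q i) * x q j)) :=
          Finset.sum_congr rfl fun i _ => Finset.sum_congr rfl fun p _ => Finset.sum_comm
      _ = _ := Finset.sum_congr rfl fun i _ => Finset.sum_comm
  rw [key]
  refine Finset.sum_le_sum fun i _ => ?_
  refine le_trans (le_of_eq ?_) (Finset.single_le_sum (f := fun j =>
    ‖∑ p, (w p : ℂ) * (x p i * (starRingEnd ℂ) (x p j))‖ ^ 2) (fun j _ => by positivity)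
    (Finset.mem_univ i))
  have : ∑ p, (w p : ℂ) * (x p i * (starRingEnd ℂ) (x p i)) =
      ((∑ p, w p * ‖x p i‖ ^ 2 : ℝ) : ℂ) := by
    push_cast
    simp_rw [Complex.mul_conj']
  simp only [this, Complex.norm_real, Real.norm_eq_abs, sq_abs]

/-- Two length-`N` windows starting at `s` and `t` on a cycle of length `2N - 1` meet as under one
aperiodic shift `τ`, with `|τ|` the cyclic distance: the length `2N - 1` is just large enough that
the two possible overlaps never occur together. -/
theorem exists_cyclic_shift {N s t : ℕ} (hs : s < 2 * N - 1) (ht : t < 2 * N - 1) :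
    ∃ τ : ℤ, |τ| < N ∧ (τ = 0 ↔ s = t) ∧ ((|τ| : ℤ) : ℝ) = cyclicDist N s t ∧
      ∀ a b : ℕ, a < N → b < N →
        ((a + s) % (2 * N - 1) = (b + t) % (2 * N - 1) ↔ (b : ℤ) = a + τ) := by
  have hcong : ∀ a b : ℕ, a < N → b < N →
      ((a + s) % (2 * N - 1) = (b + t) % (2 * N - 1) ↔
        (b + t : ℤ) - (a + s) = 0 ∨ (b + t : ℤ) - (a + s) = 2 * N - 1 ∨
          (b + t : ℤ) - (a + s) = -(2 * N - 1)) := by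
    intro a b ha hb
    have h1 := Nat.modEq_iff_dvd (n := 2 * N - 1) (a := a + s) (b := b + t)
    have hc : ((2 * N - 1 : ℕ) : ℤ) = 2 * N - 1 := by omega
    rw [hc] at h1
    push_cast at h1
    change (a + s ≡ b + t [MOD 2 * N - 1]) ↔ _
    rw [h1]
    constructor
    · rintro ⟨k, hk⟩
      have hk1 : k < 2 := by
        by_contra hcon
        have : (2 * N - 1 : ℤ) * k ≥ (2 * N - 1) * 2 :=
          mul_le_mul_of_nonneg_left (by omega) (by omega)
        omega
      have hk2 : -2 < k := by
        by_contra hcon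
        have : (2 * N - 1 : ℤ) * k ≤ (2 * N - 1) * (-2) :=
          mul_le_mul_of_nonneg_left (by omega) (by omega)
        omega
      obtain rfl | rfl | rfl : k = -1 ∨ k = 0 ∨ k = 1 := by omega
      all_goals omega
    · rintro (h | h | h) <;> rw [h]
      · exact dvd_zero _
      · exact (dvd_neg.mpr dvd_rfl)
  have hd : ∀ x : ℤ, (x : ℝ) = (t : ℝ) - s → ∀ y : ℤ, y = min |x| (2 * N - 1 - |x|) →
      (y : ℝ) = cyclicDist N s t := by
    intro x hx y hy
    rw [cyclicDist, ← hx, hy]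
    push_cast
    rfl
  have hd' := hd ((t : ℤ) - s) (by push_cast; rfl)
  rcases lt_or_ge ((s : ℤ) - t) N with h1 | h1
  · rcases lt_or_ge (-(N : ℤ)) ((s : ℤ) - t) with h2 | h2
    · refine ⟨(s : ℤ) - t, by rw [abs_lt]; omega, by omega, hd' _ ?_, ?_⟩
      · rw [abs_sub_comm, min_eq_left]; have : |(t : ℤ) - s| < N := by rw [abs_lt]; omega
        omega
      · intro a b ha hb; rw [hcong a b ha hb]; omega
    · refine ⟨(s : ℤ) - t + (2 * N - 1), by rw [abs_lt]; omega, by omega, hd' _ ?_, ?_⟩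
      · rw [abs_of_nonneg (by omega), abs_of_nonneg (by omega), min_eq_right (by omega)]; ring
      · intro a b ha hb; rw [hcong a b ha hb]; omega
  · refine ⟨(s : ℤ) - t - (2 * N - 1), by rw [abs_lt]; omega, by omega, hd' _ ?_, ?_⟩
    · rw [abs_of_nonpos (by omega), abs_of_nonpos (by omega), min_eq_right (by omega)]; ring
    · intro a b ha hb; rw [hcong a b ha hb]; omega

theorem sum_ite_shift_nat (N k : ℕ) (hk : k ≤ N) :
    ∑ a : Fin N, ∑ b : Fin N, (if (b : ℕ) = a + k then (1 : ℝ) else 0) = N - k := by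
  have h1 : ∀ a : Fin N, ∑ b : Fin N, (if (b : ℕ) = a + k then (1 : ℝ) else 0) =
      if (a : ℕ) < N - k then 1 else 0 := by
    intro a
    rw [Fin.sum_univ_eq_sum_range (fun b => if b = (a : ℕ) + k then (1 : ℝ) else 0) N,
      Finset.sum_ite_eq']
    simp only [Finset.mem_range]
    congr 1
    simp only [eq_iff_iff]
    omega
  simp_rw [h1]
  rw [Fin.sum_univ_eq_sum_range (fun a => if a < N - k then (1 : ℝ) else 0) N, ← Finset.sum_filter]
  have : (Finset.range N).filter (fun a => a < N - k) = Finset.range (N - k) := by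
    ext a; simp only [Finset.mem_filter, Finset.mem_range]; omega
  rw [this]
  simp [Nat.cast_sub hk]

/-- The number of pairs of positions in `[0, N)` that differ by `τ` is `N - |τ|`. -/
theorem sum_ite_shift (N : ℕ) (τ : ℤ) (hτ : |τ| < N) :
    ∑ a : Fin N, ∑ b : Fin N, (if ((b : ℕ) : ℤ) = ((a : ℕ) : ℤ) + τ then (1 : ℝ) else 0) =
      N - ((|τ| : ℤ) : ℝ) := by
  rw [abs_lt] at hτ
  rcases le_total 0 τ with h | h
  · lift τ to ℕ using h
    have := sum_ite_shift_nat N τ (by omega)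
    simp only [Nat.abs_cast, Int.cast_natCast]
    rw [← this]
    exact_mod_cast rfl
  · obtain ⟨k, rfl⟩ : ∃ k : ℕ, τ = -k := ⟨τ.natAbs, by omega⟩
    have := sum_ite_shift_nat N k (by omega)
    simp only [abs_neg, Nat.abs_cast, Int.cast_natCast]
    rw [← this, Finset.sum_comm]
    refine Finset.sum_congr rfl fun a _ => Finset.sum_congr rfl fun b _ => ?_
    congr 1
    simp only [eq_iff_iff]
    omega

theorem corrSum_neg {M N : ℕ} (A B : Matrix (Fin M) (Fin N) ℂ) (τ : ℤ) :
    corrSum A B (-τ) = (starRingEnd ℂ) (corrSum B A τ) := by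
  unfold corrSum aperiodicCorr
  simp only [map_sum]
  refine Finset.sum_congr rfl fun m _ => ?_
  rw [Finset.sum_comm]
  refine Finset.sum_congr rfl fun a _ => Finset.sum_congr rfl fun b _ => ?_
  by_cases h : ((b : ℕ) : ℤ) = ((a : ℕ) : ℤ) + τ
  · rw [if_pos h, if_pos (by omega)]; simp [mul_comm]
  · rw [if_neg h, if_neg (by omega)]; simp

theorem norm_corrSum_le_deltaMax_nat {K M N : ℕ} (C : Fin K → Matrix (Fin M) (Fin N) ℂ)
    (μ ν : Fin K) (τ : ℕ) (hτ : τ < N) (hne : μ ≠ ν ∨ τ ≠ 0) :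
    ‖corrSum (C μ) (C ν) (τ : ℤ)‖ ≤ deltaMax C := by
  by_cases h : μ = ν
  · subst h
    refine le_trans ?_ (le_max_left _ _)
    refine le_csSup (Set.Finite.bddAbove ?_) ⟨μ, τ, by simp at hne; omega, hτ, rfl⟩
    refine (Set.finite_range fun p : Fin K × Fin N =>
      ‖corrSum (C p.1) (C p.1) ((p.2 : ℕ) : ℤ)‖).subset ?_
    rintro x ⟨μ, τ, -, hτ, rfl⟩
    exact ⟨(μ, ⟨τ, hτ⟩), rfl⟩
  · refine le_trans ?_ (le_max_right _ _)
    refine le_csSup (Set.Finite.bddAbove ?_) ⟨μ, ν, τ, h, hτ, rfl⟩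
    refine (Set.finite_range fun p : Fin K × Fin K × Fin N =>
      ‖corrSum (C p.1) (C p.2.1) ((p.2.2 : ℕ) : ℤ)‖).subset ?_
    rintro x ⟨μ, ν, τ, -, hτ, rfl⟩
    exact ⟨(μ, ν, ⟨τ, hτ⟩), rfl⟩

theorem norm_corrSum_le_deltaMax {K M N : ℕ} (C : Fin K → Matrix (Fin M) (Fin N) ℂ)
    (μ ν : Fin K) (τ : ℤ) (hτ : |τ| < N) (hne : μ ≠ ν ∨ τ ≠ 0) :
    ‖corrSum (C μ) (C ν) τ‖ ≤ deltaMax C := by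
  rw [abs_lt] at hτ
  rcases le_total 0 τ with h | h
  · lift τ to ℕ using h
    exact norm_corrSum_le_deltaMax_nat C μ ν τ (by omega) (by simpa using hne)
  · obtain ⟨k, rfl⟩ : ∃ k : ℕ, τ = -k := ⟨τ.natAbs, by omega⟩
    rw [corrSum_neg, RCLike.norm_conj]
    exact norm_corrSum_le_deltaMax_nat C ν μ k (by omega) (by
      rcases hne with h | h
      · exact Or.inl h.symm
      · right; omega)

theorem norm_eq_one_of_overRootsOfUnity {K M N : ℕ} {C : Fin K → Matrix (Fin M) (Fin N) ℂ}
    (hC : OverRootsOfUnity C) (ν : Fin K) (m : Fin M) (n : Fin N) : ‖C ν m n‖ = 1 := by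
  obtain ⟨q, hq, h⟩ := hC
  exact Complex.norm_eq_one_of_pow_eq_one (h ν m n) hq.ne'

theorem corrSum_self_zero {M N : ℕ} (A : Matrix (Fin M) (Fin N) ℂ) (hA : ∀ m n, ‖A m n‖ = 1) :
    corrSum A A 0 = M * N := by
  unfold corrSum aperiodicCorr
  have : ∀ m : Fin M, ∀ a : Fin N, ∑ b : Fin N, (if ((b : ℕ) : ℤ) = ((a : ℕ) : ℤ) + 0 then
      A m a * (starRingEnd ℂ) (A m b) else 0) = 1 := by
    intro m a
    rw [Finset.sum_eq_single a]
    · simp [Complex.mul_conj', hA]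
    · intro b _ hb
      rw [if_neg]
      intro h
      exact hb (Fin.ext (by omega))
    · simp
  simp_rw [this]
  simp

/-- The matrix `A`, padded by zeros to row length `2N - 1` and cyclically shifted by `s`, as one
vector indexed by (row, position). -/
noncomputable def shiftVec {M N : ℕ} (A : Matrix (Fin M) (Fin N) ℂ) (s : ℕ)
    (i : Fin M × Fin (2 * N - 1)) : ℂ :=
  ∑ a : Fin N, if (a + s) % (2 * N - 1) = i.2 then A i.1 a else 0

/-- Product sum of two functions on `Fin n` after transporting them to `Fin l` along `α` and
`β`. -/
theorem sum_ite_mul_sum_ite {R : Type*} [CommSemiring R] {n l : ℕ} (α β : Fin n → ℕ)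
    (hα : ∀ a, α a < l) (u v : Fin n → R) :
    ∑ i : Fin l, (∑ a, if α a = i then u a else 0) * (∑ b, if β b = i then v b else 0) =
      ∑ a, ∑ b, if α a = β b then u a * v b else 0 := by
  simp_rw [Finset.sum_mul_sum]
  rw [Finset.sum_comm]
  refine Finset.sum_congr rfl fun a _ => ?_
  rw [Finset.sum_comm]
  refine Finset.sum_congr rfl fun b _ => ?_
  rw [Finset.sum_eq_single ⟨α a, hα a⟩]
  · by_cases h : α a = β b
    · simp [h]
    · simp [h, Ne.symm h]
  · intro i _ hi
    rw [if_neg, zero_mul]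
    intro h
    exact hi (Fin.ext h.symm)
  · simp

theorem sum_shiftVec_mul_conj {M N : ℕ} (hN : 0 < N) (A B : Matrix (Fin M) (Fin N) ℂ) (s t : ℕ)
    (τ : ℤ) (h : ∀ a b : ℕ, a < N → b < N →
        ((a + s) % (2 * N - 1) = (b + t) % (2 * N - 1) ↔ (b : ℤ) = a + τ)) :
    ∑ i, shiftVec A s i * (starRingEnd ℂ) (shiftVec B t i) = corrSum A B τ := by
  rw [Fintype.sum_prod_type]
  unfold corrSum aperiodicCorr
  refine Finset.sum_congr rfl fun m _ => ?_
  unfold shiftVec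
  simp only [map_sum, apply_ite (starRingEnd ℂ), map_zero]
  rw [sum_ite_mul_sum_ite (l := 2 * N - 1) (fun a : Fin N => (a + s) % (2 * N - 1))
    (fun a : Fin N => (a + t) % (2 * N - 1)) (fun a => Nat.mod_lt _ (by omega)) (A m)
    (fun b => (starRingEnd ℂ) (B m b))]
  refine Finset.sum_congr rfl fun a _ => Finset.sum_congr rfl fun b _ => ?_
  simp only [h a b a.2 b.2]

/-- With unimodular entries, the squared modulus of a coordinate of `shiftVec A s` is the indicator
of the window of length `N` starting at `s`; no two positions of that window collide. -/
theorem norm_sq_shiftVec {M N : ℕ} (A : Matrix (Fin M) (Fin N) ℂ) (hA : ∀ m n, ‖A m n‖ = 1)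
    (s : ℕ) (hs : s < 2 * N - 1) (i : Fin M × Fin (2 * N - 1)) :
    ‖shiftVec A s i‖ ^ 2 = ∑ a : Fin N, if (a + s) % (2 * N - 1) = i.2 then 1 else 0 := by
  unfold shiftVec
  by_cases h : ∃ a : Fin N, (a + s) % (2 * N - 1) = i.2
  · obtain ⟨a, ha⟩ := h
    have : ∀ b : Fin N, (b + s) % (2 * N - 1) = i.2 ↔ b = a := by
      intro b
      constructor
      · intro hb
        obtain ⟨τ, -, h0, -, h⟩ := exists_cyclic_shift hs hs
        have := (h b a b.2 a.2).1 (hb.trans ha.symm)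
        rw [h0.2 rfl] at this
        exact Fin.ext (by omega)
      · rintro rfl; exact ha
    simp [this, hA]
  · push Not at h
    simp [h]

/-- The generalized Levenshtein bound, for an arbitrary probability weight vector. It compares two
evaluations of `∑ w_s w_t |⟨x, y⟩|²` over all pairs of shifted matrices `x`, `y`. -/
theorem glb_le_deltaMax_sq {K M N : ℕ} (hK : 0 < K) (hN : 0 < N)
    (C : Fin K → Matrix (Fin M) (Fin N) ℂ) (hC : OverRootsOfUnity C) (w : ℕ → ℝ)
    (hw : ∀ i, 0 ≤ w i) (hw1 : ∑ i ∈ Finset.range (2 * N - 1), w i = 1)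
    (hw2 : ∑ i ∈ Finset.range (2 * N - 1), w i ^ 2 < K) :
    glb M N K w ≤ deltaMax C ^ 2 := by
  have hA := norm_eq_one_of_overRootsOfUnity hC
  set σ := ∑ i ∈ Finset.range (2 * N - 1), w i ^ 2 with hσ
  set δ := deltaMax C with hδ
  set Q := ∑ s ∈ Finset.range (2 * N - 1), ∑ t ∈ Finset.range (2 * N - 1),
    cyclicDist N s t * w s * w t with hQ
  have hK' : (0 : ℝ) < K := by exact_mod_cast hK
  have hw1' : ∑ s : Fin (2 * N - 1), w s = 1 := by
    rw [← hw1, Fin.sum_univ_eq_sum_range]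
  have hσ' : ∑ s : Fin (2 * N - 1), w s ^ 2 = σ := by
    rw [hσ, Fin.sum_univ_eq_sum_range (fun s => w s ^ 2)]
  have hQ' : ∑ s : Fin (2 * N - 1), ∑ t : Fin (2 * N - 1), cyclicDist N s t * w s * w t = Q := by
    rw [hQ, ← Fin.sum_univ_eq_sum_range
      (fun s => ∑ t ∈ Finset.range (2 * N - 1), cyclicDist N s t * w s * w t)]
    refine Finset.sum_congr rfl fun s _ => ?_
    rw [Fin.sum_univ_eq_sum_range (fun t => cyclicDist N s t * w s * w t)]
  have main := sum_sq_diag_le (P := Fin K × Fin (2 * N - 1)) (I := Fin M × Fin (2 * N - 1))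
    (fun p => w p.2) (fun p => shiftVec (C p.1) p.2)
  -- The diagonal entries of the dual Gram matrix only see the windows, so their squares add up to
  -- weighted window overlaps `N - cyclicDist N s t`.
  have lower : ∑ i : Fin M × Fin (2 * N - 1), (∑ p : Fin K × Fin (2 * N - 1),
      w p.2 * ‖shiftVec (C p.1) p.2 i‖ ^ 2) ^ 2 = M * K ^ 2 * (N - Q) := by
    have h1 : ∀ (m : Fin M) (i : Fin (2 * N - 1)), ∑ p : Fin K × Fin (2 * N - 1),
        w p.2 * ‖shiftVec (C p.1) p.2 (m, i)‖ ^ 2 = K * ∑ s : Fin (2 * N - 1), w s *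
          ∑ a : Fin N, if ((a : ℕ) + (s : ℕ)) % (2 * N - 1) = (i : ℕ) then 1 else 0 := by
      intro m i
      rw [Fintype.sum_prod_type]
      simp_rw [norm_sq_shiftVec (C _) (hA _) _ (Fin.is_lt _) (m, i)]
      rw [Finset.sum_const, Finset.card_univ, Fintype.card_fin, nsmul_eq_mul]
    rw [Fintype.sum_prod_type]
    simp_rw [h1]
    rw [Finset.sum_const, Finset.card_univ, Fintype.card_fin, nsmul_eq_mul, mul_assoc]
    congr 1
    simp_rw [mul_pow]
    rw [← Finset.mul_sum]
    congr 1
    simp_rw [sq, Finset.sum_mul_sum]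
    rw [Finset.sum_comm]
    calc _ = ∑ s : Fin (2 * N - 1), ∑ t : Fin (2 * N - 1), (N - cyclicDist N s t) * w s * w t := by
          refine Finset.sum_congr rfl fun s _ => ?_
          rw [Finset.sum_comm]
          refine Finset.sum_congr rfl fun t _ => ?_
          obtain ⟨τ, hτ, -, hdist, h⟩ := exists_cyclic_shift s.2 t.2
          rw [← hdist, ← sum_ite_shift N τ hτ]
          have h2 := sum_ite_mul_sum_ite (R := ℝ) (l := 2 * N - 1)
            (fun a : Fin N => ((a : ℕ) + s) % (2 * N - 1))
            (fun a : Fin N => ((a : ℕ) + t) % (2 * N - 1)) (fun a => Nat.mod_lt _ (by omega))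
            (fun _ => 1) (fun _ => 1)
          have h3 : ∑ a : Fin N, ∑ b : Fin N, (if ((b : ℕ) : ℤ) = ((a : ℕ) : ℤ) + τ
              then (1 : ℝ) else 0) = ∑ a : Fin N, ∑ b : Fin N,
              if ((a : ℕ) + s) % (2 * N - 1) = ((b : ℕ) + t) % (2 * N - 1)
              then (1 : ℝ) * 1 else 0 := by
            refine Finset.sum_congr rfl fun a _ => Finset.sum_congr rfl fun b _ => ?_
            simp only [h a b a.2 b.2, mul_one]
          rw [h3, ← h2, Finset.sum_mul, Finset.sum_mul]
          refine Finset.sum_congr rfl fun i _ => by ring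
      _ = _ := by
          simp_rw [sub_mul]
          simp_rw [Finset.sum_sub_distrib]
          rw [hQ']
          congr 1
          simp_rw [← Finset.mul_sum, hw1', mul_one]
          rw [← Finset.mul_sum, hw1', mul_one]
  -- Each Gram entry is a correlation sum, of modulus `M * N` for `p = q` and at most `δ` otherwise.
  have upper : ∑ p : Fin K × Fin (2 * N - 1), ∑ q : Fin K × Fin (2 * N - 1), w p.2 * w q.2 *
      ‖∑ i, shiftVec (C p.1) p.2 i * (starRingEnd ℂ) (shiftVec (C q.1) q.2 i)‖ ^ 2 ≤
      K * σ * ((M * N) ^ 2 - δ ^ 2) + K ^ 2 * δ ^ 2 := by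
    have h1 : ∀ p q : Fin K × Fin (2 * N - 1), w p.2 * w q.2 *
      ‖∑ i, shiftVec (C p.1) p.2 i * (starRingEnd ℂ) (shiftVec (C q.1) q.2 i)‖ ^ 2 ≤
      (if q = p then w p.2 ^ 2 * ((M * N) ^ 2 - δ ^ 2) else 0) + w p.2 * w q.2 * δ ^ 2 := by
      intro p q
      obtain ⟨τ, hτ, h0, -, h⟩ := exists_cyclic_shift p.2.2 q.2.2
      rw [sum_shiftVec_mul_conj hN _ _ _ _ τ h]
      split_ifs with hpq
      · subst hpq
        rw [h0.2 rfl, corrSum_self_zero _ (hA _)]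
        have : ‖(M * N : ℂ)‖ = M * N := by simp
        rw [this]
        apply le_of_eq
        ring
      · rw [zero_add]
        refine mul_le_mul_of_nonneg_left ?_ (mul_nonneg (hw _) (hw _))
        refine pow_le_pow_left₀ (norm_nonneg _) (norm_corrSum_le_deltaMax C _ _ τ hτ ?_) 2
        by_contra hcon
        push Not at hcon
        exact hpq (Prod.ext hcon.1.symm (Fin.ext (h0.1 hcon.2).symm))
    refine (Finset.sum_le_sum fun p _ => Finset.sum_le_sum fun q _ => h1 p q).trans (le_of_eq ?_)
    have hs1 : ∑ p : Fin K × Fin (2 * N - 1), w p.2 = K := by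
      rw [Fintype.sum_prod_type]
      simp [hw1']
    have hs2 : ∑ p : Fin K × Fin (2 * N - 1), w p.2 ^ 2 = K * σ := by
      rw [Fintype.sum_prod_type]
      simp [hσ']
    simp_rw [Finset.sum_add_distrib, Finset.sum_ite_eq', Finset.mem_univ, if_true]
    rw [← Finset.sum_mul, hs2]
    congr 1
    simp_rw [← Finset.sum_mul, ← Finset.mul_sum, hs1, ← Finset.sum_mul, hs1]
    ring
  have hfin : M * K ^ 2 * (N - Q) ≤ K * σ * ((M * N) ^ 2 - δ ^ 2) + K ^ 2 * δ ^ 2 := by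
    rw [← lower]; exact main.trans upper
  have hpos : 0 < 1 - 1 / (K : ℝ) * σ := by
    rw [sub_pos, one_div, inv_mul_lt_iff₀ hK']; simpa using hw2
  unfold glb quadForm
  rw [← hσ, ← hQ]
  have e : M * (N - (N * (M * N - 1) / K * σ + Q) / (1 - 1 / (K : ℝ) * σ)) =
      (M * (N - Q) - M ^ 2 * N ^ 2 * σ / K) / (1 - 1 / (K : ℝ) * σ) := by
    field_simp
    have : (K : ℝ) - σ ≠ 0 := by linarith
    field_simp
    ring
  rw [e, div_le_iff₀ hpos]
  have hK2 : (0 : ℝ) < K ^ 2 := by positivity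
  rw [← mul_le_mul_iff_of_pos_left hK2]
  calc _ = M * K ^ 2 * (N - Q) - K * σ * (M * N) ^ 2 := by field_simp
    _ ≤ K ^ 2 * δ ^ 2 - K * σ * δ ^ 2 := by linarith
    _ = _ := by field_simp

/-! ### Sums of the sine weights -/

/-- Summation of a symmetric array with zero diagonal along its diagonals. -/
theorem sum_sum_symm_eq (h : ℕ → ℕ → ℝ) (hs : ∀ s t, h s t = h t s) (h0 : ∀ s, h s s = 0)
    (m : ℕ) : ∑ s ∈ Finset.range m, ∑ t ∈ Finset.range m, h s t =
      2 * ∑ d ∈ Finset.range m, ∑ s ∈ Finset.range (m - d), h s (s + d) := by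
  induction m with
  | zero => simp
  | succ m ih =>
    have e1 : ∑ d ∈ Finset.range (m + 1), ∑ s ∈ Finset.range (m + 1 - d), h s (s + d) =
        ∑ d ∈ Finset.range (m + 1), (∑ s ∈ Finset.range (m - d), h s (s + d) + h (m - d) m) := by
      refine Finset.sum_congr rfl fun d hd => ?_
      have hd' : d ≤ m := by simpa [Nat.lt_succ_iff] using hd
      rw [Nat.succ_sub hd', Finset.sum_range_succ, Nat.sub_add_cancel hd']
    rw [e1, Finset.sum_add_distrib, Finset.sum_range_succ (fun d => ∑ s ∈ Finset.range (m - d), _),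
      Nat.sub_self, Finset.sum_range_zero, add_zero, mul_add, ← ih]
    have e2 : ∑ d ∈ Finset.range (m + 1), h (m - d) m = ∑ t ∈ Finset.range m, h t m := by
      have := Finset.sum_range_reflect (fun t => h t m) (m + 1)
      simp only [Nat.add_sub_cancel] at this
      rw [this, Finset.sum_range_succ, h0, add_zero]
    rw [e2, Finset.sum_range_succ]
    simp_rw [Finset.sum_range_succ _ m, Finset.sum_add_distrib, h0, add_zero, hs m]
    ring

theorem sin_pi_div_pos {m : ℕ} (hm : 2 ≤ m) : 0 < Real.sin (Real.pi / m) := by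
  have : (2 : ℝ) ≤ m := by exact_mod_cast hm
  apply Real.sin_pos_of_pos_of_lt_pi (by positivity)
  rw [div_lt_iff₀ (by linarith)]
  nlinarith [Real.pi_pos]

theorem cos_half_pos {m : ℕ} (hm : 2 ≤ m) : 0 < Real.cos (Real.pi / (2 * m)) := by
  have : (2 : ℝ) ≤ m := by exact_mod_cast hm
  apply Real.cos_pos_of_mem_Ioo
  have h0 : 0 < Real.pi / (2 * m) := by positivity
  refine ⟨by linarith [Real.pi_pos], ?_⟩
  apply div_lt_div_of_pos_left Real.pi_pos (by norm_num) (by linarith)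

theorem sin_half_pos {m : ℕ} (hm : 2 ≤ m) : 0 < Real.sin (Real.pi / (2 * m)) := by
  have := sin_pi_div_pos hm
  rw [show Real.pi / m = 2 * (Real.pi / (2 * m)) by field_simp, Real.sin_two_mul] at this
  have h2 := cos_half_pos hm
  by_contra hcon
  nlinarith

theorem sineWeight_nonneg {m : ℕ} (hm : 2 ≤ m) (i : ℕ) : 0 ≤ sineWeight m i := by
  unfold sineWeight
  split_ifs with h
  · refine mul_nonneg ?_ ?_
    · rw [Real.tan_eq_sin_div_cos]; exact (div_pos (sin_half_pos hm) (cos_half_pos hm)).le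
    · have hm' : (0 : ℝ) < m := by exact_mod_cast (by omega : 0 < m)
      refine Real.sin_nonneg_of_nonneg_of_le_pi (by positivity) ?_
      rw [div_le_iff₀ hm']
      have : (i : ℝ) ≤ m := by exact_mod_cast h.le
      exact mul_le_mul_of_nonneg_left this Real.pi_pos.le
  · exact le_rfl

theorem sum_range_eq_of_eq_zero_of_le {m L : ℕ} (hmL : m ≤ L) (g : ℕ → ℝ)
    (hg : ∀ i, m ≤ i → g i = 0) :
    ∑ i ∈ Finset.range L, g i = ∑ i ∈ Finset.range m, g i := by
  symm
  apply Finset.sum_subset (Finset.range_subset_range.2 hmL)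
  intro i _ hi
  exact hg i (by simpa using hi)

theorem sum_sin_range (m n : ℕ) :
    2 * Real.sin (Real.pi / (2 * m)) * ∑ i ∈ Finset.range n, Real.sin (Real.pi * i / m) =
      Real.cos (Real.pi / (2 * m)) - Real.cos (Real.pi * (2 * n - 1) / (2 * m)) := by
  induction n with
  | zero =>
    simp
    rw [show -Real.pi / (2 * m) = -(Real.pi / (2 * m)) by ring, Real.cos_neg, sub_self]
  | succ n ih =>
    rw [Finset.sum_range_succ, mul_add, ih]
    have e1 : Real.pi * (2 * ((n + 1 : ℕ) : ℝ) - 1) / (2 * m) =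
      Real.pi * n / m + Real.pi / (2 * m) := by
      push_cast
      rw [show Real.pi * n / m = Real.pi * (2 * n) / (2 * m) by
        rw [mul_left_comm, mul_div_mul_left _ _ two_ne_zero]]
      ring
    have e2 : Real.pi * (2 * (n : ℝ) - 1) / (2 * m) =
      Real.pi * n / m - Real.pi / (2 * m) := by
      rw [show Real.pi * n / m = Real.pi * (2 * n) / (2 * m) by
        rw [mul_left_comm, mul_div_mul_left _ _ two_ne_zero]]
      ring
    rw [e1, e2, Real.cos_add, Real.cos_sub]
    ring

theorem sum_sineWeight {m L : ℕ} (hm : 2 ≤ m) (hmL : m ≤ L) :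
    ∑ i ∈ Finset.range L, sineWeight m i = 1 := by
  rw [sum_range_eq_of_eq_zero_of_le hmL _ (fun i hi => by simp [sineWeight, hi])]
  have hm' : (0 : ℝ) < m := by exact_mod_cast (by omega : 0 < m)
  have e : ∀ i ∈ Finset.range m, sineWeight m i =
      Real.tan (Real.pi / (2 * m)) * Real.sin (Real.pi * i / m) := by
    intro i hi
    rw [sineWeight, if_pos (by simpa using hi)]
  rw [Finset.sum_congr rfl e, ← Finset.mul_sum]
  have h := sum_sin_range m m
  rw [show Real.pi * (2 * (m : ℝ) - 1) / (2 * m) = Real.pi - Real.pi / (2 * m) by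
    field_simp, Real.cos_pi_sub] at h
  have hc := cos_half_pos hm
  have hs := sin_half_pos hm
  rw [Real.tan_eq_sin_div_cos, div_mul_eq_mul_div, div_eq_one_iff_eq hc.ne']
  linarith

/-- Each summand times `2 sin (π / m)` is a difference of sines, so the sum telescopes. -/
theorem sum_cos_range (m d n : ℕ) :
    2 * Real.sin (Real.pi / m) * ∑ s ∈ Finset.range n, Real.cos (Real.pi * (2 * s + d) / m) =
      Real.sin (Real.pi * (2 * n + d - 1) / m) - Real.sin (Real.pi * (d - 1) / m) := by
  induction n with
  | zero => simp
  | succ n ih =>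
    rw [Finset.sum_range_succ, mul_add, ih]
    have e1 : Real.pi * (2 * ((n + 1 : ℕ) : ℝ) + d - 1) / m =
      Real.pi * (2 * n + d) / m + Real.pi / m := by
      push_cast; ring
    have e2 : Real.pi * (2 * (n : ℝ) + d - 1) / m =
      Real.pi * (2 * n + d) / m - Real.pi / m := by ring
    rw [e1, e2, Real.sin_add, Real.sin_sub]
    ring

/-- The autocorrelation at shift `d` of one half-period of the sampled sine. -/
theorem sum_sin_mul_sin {m d : ℕ} (hm : 2 ≤ m) (hd : d ≤ m) :
    ∑ s ∈ Finset.range (m - d), Real.sin (Real.pi * s / m) * Real.sin (Real.pi * (s + d : ℕ) / m) =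
      ((m - d : ℝ) * Real.cos (Real.pi * d / m) +
        Real.sin (Real.pi * d / m) * Real.cot (Real.pi / m)) / 2 := by
  have hm' : (0 : ℝ) < m := by exact_mod_cast (by omega : 0 < m)
  have hs := sin_pi_div_pos hm
  have e : ∀ s : ℕ, Real.sin (Real.pi * s / m) * Real.sin (Real.pi * (s + d : ℕ) / m) =
      (Real.cos (Real.pi * d / m) - Real.cos (Real.pi * (2 * s + d) / m)) / 2 := by
    intro s
    have e1 : Real.pi * d / m = Real.pi * (s + d : ℕ) / m - Real.pi * s / m := by push_cast; ring
    have e2 : Real.pi * (2 * s + d) / m = Real.pi * (s + d : ℕ) / m + Real.pi * s / m := by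
      push_cast; ring
    rw [e1, e2, Real.cos_add, Real.cos_sub]
    ring
  have h := sum_cos_range m d (m - d)
  rw [Nat.cast_sub hd, show Real.pi * (2 * ((m : ℝ) - d) + d - 1) / m =
    2 * Real.pi - (Real.pi * d / m + Real.pi / m) by field_simp; ring, Real.sin_two_pi_sub,
    show Real.pi * ((d : ℝ) - 1) / m = Real.pi * d / m - Real.pi / m by ring,
    Real.sin_add, Real.sin_sub] at h
  simp_rw [e]
  rw [← Finset.sum_div, Finset.sum_sub_distrib, Finset.sum_const, Finset.card_range, nsmul_eq_mul,
    Nat.cast_sub hd, Real.cot_eq_cos_div_sin]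
  congr 1
  rw [sub_eq_add_neg]
  congr 1
  field_simp
  linarith

/-- The quantity `(m tan (π / (2m)))²`, for which `tanSq m / (2m)` is the squared `ℓ²` norm of the
weight vector `sineWeight m`; it tends to `π² / 4` from above. -/
noncomputable def tanSq (m : ℕ) : ℝ := (m * Real.tan (Real.pi / (2 * m))) ^ 2

theorem sum_sineWeight_sq {m L : ℕ} (hm : 2 ≤ m) (hmL : m ≤ L) :
    ∑ i ∈ Finset.range L, sineWeight m i ^ 2 = tanSq m / (2 * m) := by
  rw [sum_range_eq_of_eq_zero_of_le hmL _ (fun i hi => by simp [sineWeight, hi])]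
  have hm' : (0 : ℝ) < m := by exact_mod_cast (by omega : 0 < m)
  have e : ∀ i ∈ Finset.range m, sineWeight m i ^ 2 = Real.tan (Real.pi / (2 * m)) ^ 2 *
      (Real.sin (Real.pi * i / m) * Real.sin (Real.pi * (i + 0 : ℕ) / m)) := by
    intro i hi
    rw [sineWeight, if_pos (by simpa using hi), add_zero]
    ring
  have h := sum_sin_mul_sin hm (Nat.zero_le m)
  rw [Nat.sub_zero] at h
  rw [Finset.sum_congr rfl e, ← Finset.mul_sum, h]
  simp [tanSq]
  field_simp

theorem cyclicDist_add (N s d : ℕ) : cyclicDist N s (s + d) = min (d : ℝ) (2 * N - 1 - d) := by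
  unfold cyclicDist
  push_cast
  rw [add_sub_cancel_left, abs_of_nonneg (Nat.cast_nonneg d)]

/-- `Q(w⁽ᵐ⁾, 0)` as a single sum over shifts, weighted by the sine autocorrelation. -/
theorem quadForm_sineWeight_zero {m N : ℕ} (hm : 2 ≤ m) (hmN : m ≤ 2 * N - 1) :
    quadForm N (sineWeight m) 0 = Real.tan (Real.pi / (2 * m)) ^ 2 *
      ∑ d ∈ Finset.range m, min (d : ℝ) (2 * N - 1 - d) *
        ((m - d : ℝ) * Real.cos (Real.pi * d / m) +
          Real.sin (Real.pi * d / m) * Real.cot (Real.pi / m)) := by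
  have hm' : (0 : ℝ) < m := by exact_mod_cast (by omega : 0 < m)
  have hz : ∀ i, m ≤ i → sineWeight m i = 0 := fun i hi => by simp [sineWeight, hi]
  rw [quadForm, zero_mul, zero_add,
    sum_range_eq_of_eq_zero_of_le hmN _ (fun i hi => by simp [hz i hi])]
  have e0 : ∀ s ∈ Finset.range m, ∑ t ∈ Finset.range (2 * N - 1),
      cyclicDist N s t * sineWeight m s * sineWeight m t = ∑ t ∈ Finset.range m,
      cyclicDist N s t * sineWeight m s * sineWeight m t := fun s _ =>
    sum_range_eq_of_eq_zero_of_le hmN _ (fun i hi => by simp [hz i hi])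
  rw [Finset.sum_congr rfl e0, sum_sum_symm_eq
    (fun s t => cyclicDist N s t * sineWeight m s * sineWeight m t)]
  · rw [Finset.mul_sum, Finset.mul_sum]
    refine Finset.sum_congr rfl fun d hd => ?_
    have hd' : d < m := by simpa using hd
    have e1 : ∀ s ∈ Finset.range (m - d),
        cyclicDist N s (s + d) * sineWeight m s * sineWeight m (s + d) =
        min (d : ℝ) (2 * N - 1 - d) * Real.tan (Real.pi / (2 * m)) ^ 2 *
          (Real.sin (Real.pi * s / m) * Real.sin (Real.pi * (s + d : ℕ) / m)) := by
      intro s hs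
      have hs' : s < m - d := by simpa using hs
      rw [cyclicDist_add, sineWeight, sineWeight, if_pos (by omega), if_pos (by omega)]
      ring
    rw [Finset.sum_congr rfl e1, ← Finset.mul_sum, sum_sin_mul_sin hm hd'.le]
    ring
  · intro s t
    simp only [cyclicDist, abs_sub_comm (t : ℝ) s]
    ring
  · intro s
    have : 0 ≤ 2 * (N : ℝ) - 1 := by
      have : (1 : ℝ) ≤ N := by exact_mod_cast (by omega : 1 ≤ N)
      linarith
    simp [cyclicDist, this]

theorem cyclicDist_nonneg {N s t : ℕ} (hs : s < 2 * N - 1) (ht : t < 2 * N - 1) :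
    0 ≤ cyclicDist N s t := by
  obtain ⟨τ, -, -, h, -⟩ := exists_cyclic_shift hs ht
  rw [← h]
  exact_mod_cast abs_nonneg τ

theorem quadForm_sineWeight_zero_nonneg {m N : ℕ} (hm : 2 ≤ m) :
    0 ≤ quadForm N (sineWeight m) 0 := by
  rw [quadForm, zero_mul, zero_add]
  refine Finset.sum_nonneg fun s hs => Finset.sum_nonneg fun t ht => ?_
  exact mul_nonneg (mul_nonneg (cyclicDist_nonneg (by simpa using hs) (by simpa using ht))
    (sineWeight_nonneg hm _)) (sineWeight_nonneg hm _)

theorem sum_sineWeight_sq_le_one {m L : ℕ} (hm : 2 ≤ m) (hmL : m ≤ L) :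
    ∑ i ∈ Finset.range L, sineWeight m i ^ 2 ≤ 1 := by
  have h1 := sum_sineWeight hm hmL
  calc _ ≤ ∑ i ∈ Finset.range L, sineWeight m i := by
        refine Finset.sum_le_sum fun i hi => ?_
        have h0 := sineWeight_nonneg hm
        have : sineWeight m i ≤ 1 := by
          rw [← h1]; exact Finset.single_le_sum (fun i _ => h0 i) hi
        nlinarith [h0 i]
    _ = 1 := h1

theorem pi_sq_div_four_le_tanSq {m : ℕ} (hm : 2 ≤ m) : Real.pi ^ 2 / 4 ≤ tanSq m := by
  have hm' : (2 : ℝ) ≤ m := by exact_mod_cast hm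
  have h := Real.le_tan (x := Real.pi / (2 * m)) (by positivity)
    (div_lt_div_of_pos_left Real.pi_pos (by norm_num) (by linarith))
  have h2 : Real.pi / 2 ≤ m * Real.tan (Real.pi / (2 * m)) := by
    calc Real.pi / 2 = m * (Real.pi / (2 * m)) := by field_simp
      _ ≤ _ := mul_le_mul_of_nonneg_left h (by linarith)
  have := pow_le_pow_left₀ (by positivity) h2 2
  unfold tanSq
  linarith [this]

/-! ### The limiting integral -/

/-- Left Riemann sums of an `L`-Lipschitz function on `[0, 1]` have error at most `L / m`. -/
theorem abs_riemannSum_sub_integral_le {g : ℝ → ℝ} {L : ℝ} (hL : 0 ≤ L)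
    (hg : ∀ u ∈ Set.Icc (0 : ℝ) 1, ∀ v ∈ Set.Icc (0 : ℝ) 1, |g u - g v| ≤ L * |u - v|)
    {m : ℕ} (hm : 0 < m) :
    |1 / (m : ℝ) * ∑ d ∈ Finset.range m, g (d / m) - ∫ u in (0 : ℝ)..1, g u| ≤ L / m := by
  have hm' : (0 : ℝ) < m := by exact_mod_cast hm
  have hcont : ContinuousOn g (Set.Icc 0 1) := by
    have : LipschitzOnWith (Real.toNNReal L) g (Set.Icc 0 1) := by
      refine LipschitzOnWith.of_dist_le_mul fun u hu v hv => ?_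
      rw [Real.dist_eq, Real.dist_eq, Real.coe_toNNReal _ hL]
      exact hg u hu v hv
    exact this.continuousOn
  have hmono : ∀ k : ℕ, (k : ℝ) / m ≤ (k + 1 : ℕ) / m := fun k => by
    gcongr; exact Nat.le_succ k
  have hsub : ∀ k < m, Set.Icc ((k : ℝ) / m) ((k + 1 : ℕ) / m) ⊆ Set.Icc 0 1 := by
    intro k hk
    refine Set.Icc_subset_Icc (by positivity) ?_
    rw [div_le_one hm']
    exact_mod_cast hk
  have hint : ∀ k < m, IntervalIntegrable g MeasureTheory.volume ((k : ℝ) / m)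
      ((k + 1 : ℕ) / m) := by
    intro k hk
    apply ContinuousOn.intervalIntegrable
    rw [Set.uIcc_of_le (hmono k)]
    exact hcont.mono (hsub k hk)
  have hsum := intervalIntegral.sum_integral_adjacent_intervals (a := fun k : ℕ => (k : ℝ) / m) hint
  simp only [Nat.cast_zero, zero_div, div_self hm'.ne'] at hsum
  rw [← hsum, Finset.mul_sum, ← Finset.sum_sub_distrib]
  refine (Finset.abs_sum_le_sum_abs _ _).trans ?_
  have hterm : ∀ k ∈ Finset.range m, |1 / (m : ℝ) * g (k / m) -
      ∫ x in ((k : ℝ) / m)..((k + 1 : ℕ) / m), g x| ≤ L / m * (1 / m) := by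
    intro k hk
    have hk' : k < m := by simpa using hk
    have hlen : ((k + 1 : ℕ) : ℝ) / m - k / m = 1 / m := by push_cast; ring
    have e : 1 / (m : ℝ) * g (k / m) - ∫ x in ((k : ℝ) / m)..((k + 1 : ℕ) / m), g x =
        ∫ x in ((k : ℝ) / m)..((k + 1 : ℕ) / m), (g (k / m) - g x) := by
      rw [intervalIntegral.integral_sub (by simp) (hint k hk'), intervalIntegral.integral_const,
        hlen, smul_eq_mul]
    rw [e, ← Real.norm_eq_abs]
    refine (intervalIntegral.norm_integral_le_of_norm_le_const (C := L / m) ?_).trans ?_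
    · intro x hx
      rw [Set.uIoc_of_le (hmono k)] at hx
      rw [Real.norm_eq_abs]
      refine (hg _ (hsub k hk' (Set.left_mem_Icc.2 (hmono k))) x
        (hsub k hk' (Set.Ioc_subset_Icc_self hx))).trans ?_
      rw [div_eq_mul_one_div L]
      refine mul_le_mul_of_nonneg_left ?_ hL
      rw [abs_sub_comm, abs_of_nonneg (by linarith [hx.1])]
      linarith [hx.2]
    · rw [hlen, abs_of_pos (by positivity)]
  refine (Finset.sum_le_sum hterm).trans (le_of_eq ?_)
  rw [Finset.sum_const, Finset.card_range, nsmul_eq_mul]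
  field_simp

/-- The normalized autocorrelation `(1 - u) cos (πu) + sin (πu) / π` of `sin (π ·)` on `[0, 1]`,
which is twice `∫ x in 0..1-u, sin (π x) sin (π (x + u))`. -/
noncomputable def sineCorr (u : ℝ) : ℝ :=
  (1 - u) * Real.cos (Real.pi * u) + Real.sin (Real.pi * u) / Real.pi

theorem hasDerivAt_cos_pi_mul (u : ℝ) :
    HasDerivAt (fun u => Real.cos (Real.pi * u)) (-Real.sin (Real.pi * u) * Real.pi) u := by
  have := ((hasDerivAt_id u).const_mul Real.pi).cos
  simpa using this

theorem hasDerivAt_sin_pi_mul (u : ℝ) :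
    HasDerivAt (fun u => Real.sin (Real.pi * u)) (Real.cos (Real.pi * u) * Real.pi) u := by
  have := ((hasDerivAt_id u).const_mul Real.pi).sin
  simpa using this

theorem hasDerivAt_sineCorr (u : ℝ) :
    HasDerivAt sineCorr (-((1 - u) * Real.sin (Real.pi * u) * Real.pi)) u := by
  have h := (((hasDerivAt_id u).const_sub 1).mul (hasDerivAt_cos_pi_mul u)).add
    ((hasDerivAt_sin_pi_mul u).div_const Real.pi)
  refine h.congr_deriv ?_
  have := Real.pi_ne_zero
  simp
  field_simp

theorem continuous_sineCorr : Continuous sineCorr := by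
  unfold sineCorr
  fun_prop

theorem abs_sineCorr_sub_le {u v : ℝ} (hu : u ∈ Set.Icc (0 : ℝ) 1) (hv : v ∈ Set.Icc (0 : ℝ) 1) :
    |sineCorr u - sineCorr v| ≤ 4 * |u - v| := by
  have := Convex.norm_image_sub_le_of_norm_hasDerivWithin_le (f := sineCorr) (s := Set.Icc 0 1)
    (C := 4) (fun x _ => (hasDerivAt_sineCorr x).hasDerivWithinAt) ?_ (convex_Icc 0 1) hv hu
  · simpa using this
  · intro x hx
    rw [Real.norm_eq_abs, abs_neg, abs_mul, abs_mul, abs_of_pos Real.pi_pos,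
      abs_of_nonneg (by linarith [hx.2] : 0 ≤ 1 - x)]
    have h1 : (1 - x) * |Real.sin (Real.pi * x)| ≤ 1 * 1 :=
      mul_le_mul (by linarith [hx.1]) (Real.abs_sin_le_one _) (abs_nonneg _) zero_le_one
    calc _ ≤ 1 * 1 * Real.pi := mul_le_mul_of_nonneg_right h1 Real.pi_pos.le
      _ ≤ 4 := by linarith [Real.pi_le_four]

theorem abs_one_sub_mul_cos_le {u : ℝ} (hu : u ∈ Set.Icc (0 : ℝ) 1) :
    |(1 - u) * Real.cos (Real.pi * u)| ≤ 1 := by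
  rw [abs_mul]
  refine mul_le_one₀ ?_ (abs_nonneg _) (Real.abs_cos_le_one _)
  rw [abs_le]; constructor <;> linarith [hu.1, hu.2]

theorem abs_sineCorr_le {u : ℝ} (hu : u ∈ Set.Icc (0 : ℝ) 1) : |sineCorr u| ≤ 2 := by
  unfold sineCorr
  refine (abs_add_le _ _).trans ?_
  have h1 := abs_one_sub_mul_cos_le hu
  have h2 : |Real.sin (Real.pi * u) / Real.pi| ≤ 1 := by
    rw [abs_div, abs_of_pos Real.pi_pos, div_le_one Real.pi_pos]
    linarith [Real.abs_sin_le_one (Real.pi * u), Real.pi_gt_three]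
  linarith

theorem abs_min_le_one {ρ u : ℝ} (hρ : ρ ∈ Set.Icc (0 : ℝ) 2) (hu : u ∈ Set.Icc (0 : ℝ) 1) :
    |min (ρ * u) (2 - ρ * u)| ≤ 1 := by
  have h1 : 0 ≤ ρ * u := mul_nonneg hρ.1 hu.1
  have h2 : ρ * u ≤ 2 * 1 := mul_le_mul hρ.2 hu.2 hu.1 (by norm_num)
  rw [abs_of_nonneg (le_min h1 (by linarith))]
  rcases le_total (ρ * u) 1 with h | h
  · exact (min_le_left _ _).trans h
  · exact (min_le_right _ _).trans (by linarith)

theorem abs_limitIntegrand_sub_le {ρ u v : ℝ} (hρ : ρ ∈ Set.Icc (0 : ℝ) 2)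
    (hu : u ∈ Set.Icc (0 : ℝ) 1) (hv : v ∈ Set.Icc (0 : ℝ) 1) :
    |min (ρ * u) (2 - ρ * u) * sineCorr u - min (ρ * v) (2 - ρ * v) * sineCorr v| ≤
      8 * |u - v| := by
  have e : min (ρ * u) (2 - ρ * u) * sineCorr u - min (ρ * v) (2 - ρ * v) * sineCorr v =
      (min (ρ * u) (2 - ρ * u) - min (ρ * v) (2 - ρ * v)) * sineCorr u +
      min (ρ * v) (2 - ρ * v) * (sineCorr u - sineCorr v) := by ring
  have h1 : |min (ρ * u) (2 - ρ * u) - min (ρ * v) (2 - ρ * v)| ≤ 2 * |u - v| := by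
    refine (abs_min_sub_min_le_max _ _ _ _).trans (max_le ?_ ?_)
    · rw [← mul_sub, abs_mul, abs_of_nonneg hρ.1]
      exact mul_le_mul_of_nonneg_right hρ.2 (abs_nonneg _)
    · rw [sub_sub_sub_cancel_left, ← mul_sub, abs_mul, abs_of_nonneg hρ.1, abs_sub_comm]
      exact mul_le_mul_of_nonneg_right hρ.2 (abs_nonneg _)
  rw [e]
  refine (abs_add_le _ _).trans ?_
  rw [abs_mul, abs_mul]
  have h2 := mul_le_mul h1 (abs_sineCorr_le hu) (abs_nonneg _) (by positivity)
  have h3 := mul_le_mul (abs_min_le_one hρ hv) (abs_sineCorr_sub_le hu hv) (abs_nonneg _)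
    zero_le_one
  linarith

theorem integral_sineCorr (a b : ℝ) : ∫ u in a..b, sineCorr u =
    ((1 - b) * Real.sin (Real.pi * b) / Real.pi - 2 * Real.cos (Real.pi * b) / Real.pi ^ 2) -
    ((1 - a) * Real.sin (Real.pi * a) / Real.pi - 2 * Real.cos (Real.pi * a) / Real.pi ^ 2) := by
  refine intervalIntegral.integral_eq_sub_of_hasDerivAt (f := fun u => (1 - u) *
    Real.sin (Real.pi * u) / Real.pi - 2 * Real.cos (Real.pi * u) / Real.pi ^ 2) ?_
    (continuous_sineCorr.intervalIntegrable _ _)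
  intro u _
  have h := ((((hasDerivAt_id u).const_sub 1).mul (hasDerivAt_sin_pi_mul u)).div_const Real.pi).sub
    (((hasDerivAt_cos_pi_mul u).const_mul 2).div_const (Real.pi ^ 2))
  refine h.congr_deriv ?_
  have := Real.pi_ne_zero
  unfold sineCorr
  simp
  field_simp
  ring

theorem integral_mul_sineCorr (a b : ℝ) : ∫ u in a..b, u * sineCorr u =
    (b * (1 - b) * Real.sin (Real.pi * b) / Real.pi -
      (3 * b - 1) * Real.cos (Real.pi * b) / Real.pi ^ 2 +
      3 * Real.sin (Real.pi * b) / Real.pi ^ 3) -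
    (a * (1 - a) * Real.sin (Real.pi * a) / Real.pi -
      (3 * a - 1) * Real.cos (Real.pi * a) / Real.pi ^ 2 +
      3 * Real.sin (Real.pi * a) / Real.pi ^ 3) := by
  refine intervalIntegral.integral_eq_sub_of_hasDerivAt (f := fun u => u * (1 - u) *
    Real.sin (Real.pi * u) / Real.pi - (3 * u - 1) * Real.cos (Real.pi * u) / Real.pi ^ 2 +
      3 * Real.sin (Real.pi * u) / Real.pi ^ 3) ?_
    ((continuous_id.mul continuous_sineCorr).intervalIntegrable _ _)
  intro u _
  have h := (((((hasDerivAt_id u).mul ((hasDerivAt_id u).const_sub 1)).mul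
    (hasDerivAt_sin_pi_mul u)).div_const Real.pi).sub
    (((((hasDerivAt_id u).const_mul 3).sub_const 1).mul (hasDerivAt_cos_pi_mul u)).div_const
      (Real.pi ^ 2))).add (((hasDerivAt_sin_pi_mul u).const_mul 3).div_const (Real.pi ^ 3))
  refine h.congr_deriv ?_
  have := Real.pi_ne_zero
  unfold sineCorr
  simp
  field_simp
  ring

/-- The integral form of the limit function `f`: for `ρ > 1` the minimum switches branch at
`u = 1 / ρ`, which produces the terms in `cos (π / ρ)` and `sin (π / ρ)`. -/
theorem integral_min_mul_sineCorr {ρ : ℝ} (h0 : 0 < ρ) :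
    Real.pi ^ 2 / 4 * ∫ u in (0 : ℝ)..1, min (ρ * u) (2 - ρ * u) * sineCorr u = limitQ ρ := by
  have hpi := Real.pi_ne_zero
  unfold limitQ
  split_ifs with h1
  · have e : ∫ u in (0 : ℝ)..1, min (ρ * u) (2 - ρ * u) * sineCorr u =
        ∫ u in (0 : ℝ)..1, ρ * (u * sineCorr u) := by
      refine intervalIntegral.integral_congr fun u hu => ?_
      rw [Set.uIcc_of_le zero_le_one] at hu
      have : ρ * u ≤ 1 * 1 := mul_le_mul h1 hu.2 hu.1 zero_le_one
      rw [min_eq_left (by linarith)]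
      ring
    rw [e, intervalIntegral.integral_const_mul, integral_mul_sineCorr]
    simp
    field_simp
    ring
  · push Not at h1
    have hv0 : 0 < 1 / ρ := by positivity
    have hv1 : 1 / ρ ≤ 1 := by rw [div_le_one h0]; exact h1.le
    have hc : Continuous fun u => min (ρ * u) (2 - ρ * u) * sineCorr u :=
      Continuous.mul (by fun_prop) continuous_sineCorr
    rw [← intervalIntegral.integral_add_adjacent_intervals (b := 1 / ρ)
      (hc.intervalIntegrable _ _) (hc.intervalIntegrable _ _)]
    have e1 : ∫ u in (0 : ℝ)..(1 / ρ), min (ρ * u) (2 - ρ * u) * sineCorr u =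
        ∫ u in (0 : ℝ)..(1 / ρ), ρ * (u * sineCorr u) := by
      refine intervalIntegral.integral_congr fun u hu => ?_
      rw [Set.uIcc_of_le hv0.le] at hu
      have : ρ * u ≤ 1 := by rw [← le_div_iff₀' h0]; exact hu.2
      rw [min_eq_left (by linarith)]
      ring
    have e2 : ∫ u in (1 / ρ)..(1 : ℝ), min (ρ * u) (2 - ρ * u) * sineCorr u =
        ∫ u in (1 / ρ)..(1 : ℝ), (2 * sineCorr u - ρ * (u * sineCorr u)) := by
      refine intervalIntegral.integral_congr fun u hu => ?_
      rw [Set.uIcc_of_le hv1] at hu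
      have : 1 ≤ ρ * u := by rw [← div_le_iff₀' h0]; exact hu.1
      rw [min_eq_right (by linarith)]
      ring
    have hcs := continuous_sineCorr
    have hc1 : Continuous fun u => 2 * sineCorr u := by fun_prop
    have hc2 : Continuous fun u => ρ * (u * sineCorr u) := by fun_prop
    rw [e1, e2, intervalIntegral.integral_sub (hc1.intervalIntegrable _ _)
      (hc2.intervalIntegrable _ _),
      intervalIntegral.integral_const_mul, intervalIntegral.integral_const_mul,
      intervalIntegral.integral_const_mul, integral_mul_sineCorr, integral_mul_sineCorr,
      integral_sineCorr]
    simp only [mul_one, mul_one_div, Real.sin_pi, Real.cos_pi, mul_zero, Real.sin_zero,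
      Real.cos_zero]
    field_simp
    ring

/-! ### Limits of the quadratic form and of the bound -/

/-- For `f` with `f 0 = 0` and `f' 0 = c`, one has `m f (a / m) → a c`. -/
theorem tendsto_nat_mul_comp_div {f : ℝ → ℝ} {c : ℝ} (hf : HasDerivAt f c 0) (h0 : f 0 = 0)
    (a : ℝ) : Tendsto (fun m : ℕ => (m : ℝ) * f (a / m)) atTop (𝓝 (a * c)) := by
  have h1 : HasDerivAt (fun x => f (a * x)) (c * a) 0 := by
    have h2 : HasDerivAt (fun x : ℝ => a * x) a 0 := by
      simpa using (hasDerivAt_id (0 : ℝ)).const_mul a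
    exact HasDerivAt.comp (0 : ℝ) (by simpa using hf) h2
  rw [hasDerivAt_iff_tendsto_slope_zero] at h1
  have h3 : Tendsto (fun m : ℕ => ((m : ℝ))⁻¹) atTop (𝓝[≠] 0) := by
    refine tendsto_nhdsWithin_iff.2 ⟨tendsto_inv_atTop_nhds_zero_nat, ?_⟩
    filter_upwards [eventually_gt_atTop 0] with m hm
    have : (m : ℝ) ≠ 0 := by exact_mod_cast hm.ne'
    simpa using this
  have h4 := h1.comp h3
  rw [mul_comm a c]
  refine h4.congr fun m => ?_
  simp [h0, div_eq_mul_inv]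

theorem tendsto_tanSq : Tendsto tanSq atTop (𝓝 (Real.pi ^ 2 / 4)) := by
  have h : HasDerivAt Real.tan 1 0 := by
    simpa using Real.hasDerivAt_tan (x := 0) (by simp)
  have := (tendsto_nat_mul_comp_div h Real.tan_zero (Real.pi / 2)).pow 2
  rw [show (Real.pi / 2 * 1) ^ 2 = Real.pi ^ 2 / 4 by ring] at this
  refine this.congr fun m => ?_
  rw [tanSq, div_div]

theorem tendsto_cot_div : Tendsto (fun m : ℕ => Real.cot (Real.pi / m) / m) atTop
    (𝓝 (1 / Real.pi)) := by
  have h : HasDerivAt Real.sin 1 0 := by simpa using Real.hasDerivAt_sin 0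
  have h1 := tendsto_nat_mul_comp_div h Real.sin_zero Real.pi
  rw [mul_one] at h1
  have h2 : Tendsto (fun m : ℕ => Real.cos (Real.pi / m)) atTop (𝓝 1) := by
    have := (Real.continuous_cos.tendsto 0).comp (tendsto_const_div_atTop_nhds_zero_nat Real.pi)
    simpa [Function.comp_def] using this
  refine (h2.div h1 Real.pi_ne_zero).congr fun m => ?_
  rw [Real.cot_eq_cos_div_sin, div_div, mul_comm]
  rfl

/-- The error in `cot (π / m) / m → 1 / π`. -/
noncomputable def cotErr (m : ℕ) : ℝ := |Real.cot (Real.pi / m) / m - 1 / Real.pi|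

/-- A bound for the distance between `Q(w⁽ᵐ⁾, 0) / (N · tanSq m)`, an average over shifts, and the
limiting integral: the perturbed integrand contributes the first two terms, the Riemann sum the
last. -/
noncomputable def riemannErr (m : ℕ) : ℝ := 2 / m * (2 + cotErr m) + cotErr m + 8 / m

/-- A bound, uniform in `N ≥ (m + 1) / 2`, for `|Q(w⁽ᵐ⁾, 0) / N - f (m / N)|`. -/
noncomputable def quadErr (m : ℕ) : ℝ :=
  |tanSq m - Real.pi ^ 2 / 4| * (2 + riemannErr m) + Real.pi ^ 2 / 4 * riemannErr m

theorem tendsto_quadErr : Tendsto quadErr atTop (𝓝 0) := by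
  have h1 : Tendsto cotErr atTop (𝓝 0) := by
    have := (tendsto_cot_div.sub_const (1 / Real.pi)).abs
    unfold cotErr
    simpa using this
  have h2 : Tendsto riemannErr atTop (𝓝 0) := by
    have := (((tendsto_const_div_atTop_nhds_zero_nat 2).mul (h1.const_add 2)).add h1).add
      (tendsto_const_div_atTop_nhds_zero_nat 8)
    unfold riemannErr
    simpa using this
  have h3 := (tendsto_tanSq.sub_const (Real.pi ^ 2 / 4)).abs
  have := (h3.mul (h2.const_add 2)).add (h2.const_mul (Real.pi ^ 2 / 4))
  unfold quadErr
  simpa using this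

theorem quadForm_sineWeight_zero_div {m N : ℕ} (hm : 2 ≤ m) (hmN : m ≤ 2 * N - 1) :
    quadForm N (sineWeight m) 0 / N = tanSq m * (1 / (m : ℝ) * ∑ d ∈ Finset.range m,
      min ((m : ℝ) / N * (d / m)) (2 - 1 / N - (m : ℝ) / N * (d / m)) *
        ((1 - (d : ℝ) / m) * Real.cos (Real.pi * (d / m)) +
          Real.sin (Real.pi * (d / m)) * (Real.cot (Real.pi / m) / m))) := by
  have hm' : (0 : ℝ) < m := by exact_mod_cast (by omega : 0 < m)
  have hN : (0 : ℝ) < N := by exact_mod_cast (by omega : 0 < N)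
  rw [quadForm_sineWeight_zero hm hmN, tanSq, mul_div_assoc, Finset.sum_div, mul_pow,
    mul_comm ((m : ℝ) ^ 2), mul_assoc, ← mul_assoc ((m : ℝ) ^ 2)]
  congr 1
  rw [Finset.mul_sum]
  refine Finset.sum_congr rfl fun d _ => ?_
  have e1 : (m : ℝ) / N * (d / m) = d / N := by field_simp
  have e2 : (2 - 1 / (N : ℝ) - d / N) = (2 * N - 1 - d) / N := by field_simp
  rw [e1, e2, min_div_div_right hN.le, ← mul_div_assoc]
  field_simp

/-- The convergence `Q(w⁽ᵐ⁾, 0) / N → f (m / N)` with an error depending on `m` only. The uniformity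
is what allows the bound to be optimized over `m` before passing to the limit. -/
theorem abs_quadForm_sineWeight_sub_le {m N : ℕ} (hm : 2 ≤ m) (hmN : m ≤ 2 * N - 1) :
    |quadForm N (sineWeight m) 0 / N - limitQ ((m : ℝ) / N)| ≤ quadErr m := by
  have hm' : (0 : ℝ) < m := by exact_mod_cast (by omega : 0 < m)
  have hN : (0 : ℝ) < N := by exact_mod_cast (by omega : 0 < N)
  have hmN' : (m : ℝ) ≤ 2 * N := by exact_mod_cast (by omega : m ≤ 2 * N)
  set ρ : ℝ := (m : ℝ) / N with hρ
  have hρ0 : 0 < ρ := by positivity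
  have hρ2 : ρ ≤ 2 := by rw [hρ, div_le_iff₀ hN]; exact hmN'
  have hρ' : ρ ∈ Set.Icc (0 : ℝ) 2 := ⟨hρ0.le, hρ2⟩
  rw [quadForm_sineWeight_zero_div hm hmN, ← integral_min_mul_sineCorr hρ0]
  set β := Real.cot (Real.pi / m) / m with hβ
  set S := 1 / (m : ℝ) * ∑ d ∈ Finset.range m, min (ρ * (d / m)) (2 - 1 / N - ρ * (d / m)) *
        ((1 - (d : ℝ) / m) * Real.cos (Real.pi * (d / m)) +
          Real.sin (Real.pi * (d / m)) * β) with hS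
  set I := ∫ u in (0 : ℝ)..1, min (ρ * u) (2 - ρ * u) * sineCorr u with hI
  have hb : |β - 1 / Real.pi| = cotErr m := rfl
  have hb0 : 0 ≤ cotErr m := abs_nonneg _
  have hpi1 : 1 / Real.pi ≤ 1 := by
    rw [div_le_one Real.pi_pos]; linarith [Real.pi_gt_three]
  have hpi0 : 0 < 1 / Real.pi := by positivity
  have hβ1 : |β| ≤ 1 + cotErr m := by
    have := abs_add_le (β - 1 / Real.pi) (1 / Real.pi)
    rw [sub_add_cancel, abs_of_pos hpi0, hb] at this
    linarith
  have hNm : 1 / (N : ℝ) ≤ 2 / m := by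
    rw [div_le_div_iff₀ hN hm']; linarith
  -- `2 - 1 / N` and `β` differ from their limits `2` and `1 / π` by at most `2 / m` and `cotErr m`.
  have hpt : ∀ u ∈ Set.Icc (0 : ℝ) 1, |min (ρ * u) (2 - 1 / N - ρ * u) *
      ((1 - u) * Real.cos (Real.pi * u) + Real.sin (Real.pi * u) * β) -
      min (ρ * u) (2 - ρ * u) * sineCorr u| ≤ 2 / m * (2 + cotErr m) + cotErr m := by
    intro u hu
    have e : min (ρ * u) (2 - 1 / N - ρ * u) *
      ((1 - u) * Real.cos (Real.pi * u) + Real.sin (Real.pi * u) * β) -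
      min (ρ * u) (2 - ρ * u) * sineCorr u =
      (min (ρ * u) (2 - 1 / N - ρ * u) - min (ρ * u) (2 - ρ * u)) *
        ((1 - u) * Real.cos (Real.pi * u) + Real.sin (Real.pi * u) * β) +
      min (ρ * u) (2 - ρ * u) * (Real.sin (Real.pi * u) * (β - 1 / Real.pi)) := by
      unfold sineCorr; ring
    rw [e]
    have h1 : |min (ρ * u) (2 - 1 / N - ρ * u) - min (ρ * u) (2 - ρ * u)| ≤ 2 / m := by
      refine (abs_min_sub_min_le_max _ _ _ _).trans (max_le ?_ ?_)
      · rw [sub_self, abs_zero]; positivity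
      · rw [show 2 - 1 / (N : ℝ) - ρ * u - (2 - ρ * u) = -(1 / N) by ring, abs_neg,
          abs_of_pos (by positivity)]
        exact hNm
    have h2 : |(1 - u) * Real.cos (Real.pi * u) + Real.sin (Real.pi * u) * β| ≤ 2 + cotErr m := by
      refine (abs_add_le _ _).trans ?_
      have h3 : |Real.sin (Real.pi * u) * β| ≤ 1 * (1 + cotErr m) := by
        rw [abs_mul]
        exact mul_le_mul (Real.abs_sin_le_one _) hβ1 (abs_nonneg _) zero_le_one
      linarith [abs_one_sub_mul_cos_le hu]
    have h4 : |Real.sin (Real.pi * u) * (β - 1 / Real.pi)| ≤ 1 * cotErr m := by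
      rw [abs_mul, hb]
      exact mul_le_mul_of_nonneg_right (Real.abs_sin_le_one _) hb0
    refine (abs_add_le _ _).trans ?_
    rw [abs_mul, abs_mul]
    refine add_le_add (mul_le_mul h1 h2 (abs_nonneg _) (by positivity)) ?_
    have := mul_le_mul (abs_min_le_one hρ' hu) h4 (abs_nonneg _) zero_le_one
    linarith
  have hS1 : |S - 1 / (m : ℝ) * ∑ d ∈ Finset.range m,
      min (ρ * (d / m)) (2 - ρ * (d / m)) * sineCorr (d / m)| ≤
      2 / m * (2 + cotErr m) + cotErr m := by
    rw [hS, ← mul_sub, ← Finset.sum_sub_distrib, abs_mul, abs_of_pos (by positivity)]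
    have : |∑ d ∈ Finset.range m, (min (ρ * (d / m)) (2 - 1 / N - ρ * (d / m)) *
        ((1 - (d : ℝ) / m) * Real.cos (Real.pi * (d / m)) + Real.sin (Real.pi * (d / m)) * β) -
        min (ρ * (d / m)) (2 - ρ * (d / m)) * sineCorr (d / m))| ≤
        m * (2 / m * (2 + cotErr m) + cotErr m) := by
      refine (Finset.abs_sum_le_sum_abs _ _).trans ?_
      refine (Finset.sum_le_sum (g := fun _ => 2 / m * (2 + cotErr m) + cotErr m)
        fun d hd => hpt _ ⟨by positivity, ?_⟩).trans ?_
      · rw [div_le_one hm']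
        exact_mod_cast (by simpa using hd : d < m).le
      · rw [Finset.sum_const, Finset.card_range, nsmul_eq_mul]
    calc _ ≤ 1 / (m : ℝ) * (m * (2 / m * (2 + cotErr m) + cotErr m)) :=
          mul_le_mul_of_nonneg_left this (by positivity)
      _ = _ := by field_simp
  have hS2 : |1 / (m : ℝ) * ∑ d ∈ Finset.range m,
      min (ρ * (d / m)) (2 - ρ * (d / m)) * sineCorr (d / m) - I| ≤ 8 / m :=
    abs_riemannSum_sub_integral_le (g := fun u => min (ρ * u) (2 - ρ * u) * sineCorr u)
      (by norm_num) (fun u hu v hv => abs_limitIntegrand_sub_le hρ' hu hv) (by omega)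
  have hSI : |S - I| ≤ riemannErr m := by
    refine (abs_sub_le _ _ _).trans (add_le_add hS1 hS2)
  have hI2 : |I| ≤ 2 := by
    have := intervalIntegral.norm_integral_le_of_norm_le_const (a := 0) (b := 1) (C := 2)
      (f := fun u => min (ρ * u) (2 - ρ * u) * sineCorr u) ?_
    · simpa using this
    · intro u hu
      rw [Set.uIoc_of_le zero_le_one] at hu
      have hu' := Set.Ioc_subset_Icc_self hu
      rw [Real.norm_eq_abs, abs_mul]
      have := mul_le_mul (abs_min_le_one hρ' hu') (abs_sineCorr_le hu') (abs_nonneg _) zero_le_one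
      linarith
  have hS3 : |S| ≤ 2 + riemannErr m := by
    have := abs_add_le (S - I) I
    rw [sub_add_cancel] at this
    linarith
  rw [show tanSq m * S - Real.pi ^ 2 / 4 * I = (tanSq m - Real.pi ^ 2 / 4) * S +
    Real.pi ^ 2 / 4 * (S - I) by ring]
  refine (abs_add_le _ _).trans ?_
  rw [abs_mul _ S, abs_mul _ (S - I), abs_of_pos (by positivity : 0 < Real.pi ^ 2 / 4)]
  exact add_le_add (mul_le_mul_of_nonneg_left hS3 (abs_nonneg _))
    (mul_le_mul_of_nonneg_left hSI (by positivity))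

theorem continuousAt_limitQ {r : ℝ} (h0 : 0 < r) : ContinuousAt limitQ r := by
  have hc : ContinuousOn limitQ (Set.Ioi 0) := by
    unfold limitQ
    have hfr : frontier {r : ℝ | r ≤ 1} = {1} := frontier_Iic
    refine ContinuousOn.if ?_ ?_ ?_
    · intro a ha
      rw [hfr] at ha
      have : a = 1 := ha.2
      subst this
      norm_num
    · fun_prop
    · refine ContinuousOn.mono (s := Set.Ioi 0) ?_ Set.inter_subset_left
      have : ContinuousOn (fun r : ℝ => Real.pi / r) (Set.Ioi 0) :=
        continuousOn_const.div continuousOn_id fun x hx => (ne_of_gt hx)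
      fun_prop
  exact hc.continuousAt (Ioi_mem_nhds h0)

theorem tendsto_atTop_of_div_tendsto {m : ℕ → ℕ} {r : ℝ} (h0 : 0 < r)
    (hm : Tendsto (fun N : ℕ => (m N : ℝ) / N) atTop (𝓝 r)) : Tendsto m atTop atTop := by
  have h1 : Tendsto (fun N : ℕ => (m N : ℝ) / N * N) atTop atTop :=
    hm.pos_mul_atTop h0 tendsto_natCast_atTop_atTop
  rw [← tendsto_natCast_atTop_iff (R := ℝ)]
  refine h1.congr' ?_
  filter_upwards [eventually_gt_atTop 0] with N hN
  have : (N : ℝ) ≠ 0 := by exact_mod_cast hN.ne'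
  field_simp

theorem eventually_le_of_div_tendsto {m : ℕ → ℕ} {r : ℝ} (h2 : r < 2)
    (hm : Tendsto (fun N : ℕ => (m N : ℝ) / N) atTop (𝓝 r)) :
    ∀ᶠ N : ℕ in atTop, m N ≤ 2 * N - 1 := by
  filter_upwards [hm.eventually (gt_mem_nhds h2), eventually_gt_atTop 0] with N hN hN0
  have : (0 : ℝ) < N := by exact_mod_cast hN0
  rw [div_lt_iff₀ this] at hN
  have : m N < 2 * N := by exact_mod_cast hN
  omega

theorem tendsto_quadForm_sineWeight {r : ℝ} (h0 : 0 < r) (h2 : r < 2) {m : ℕ → ℕ}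
    (hm : Tendsto (fun N : ℕ => (m N : ℝ) / N) atTop (𝓝 r)) :
    Tendsto (fun N : ℕ => quadForm N (sineWeight (m N)) 0 / N) atTop (𝓝 (limitQ r)) := by
  have hmt := tendsto_atTop_of_div_tendsto h0 hm
  have h1 : Tendsto (fun N : ℕ => quadForm N (sineWeight (m N)) 0 / N - limitQ ((m N : ℝ) / N))
      atTop (𝓝 0) := by
    refine squeeze_zero_norm' ?_ (tendsto_quadErr.comp hmt)
    filter_upwards [eventually_le_of_div_tendsto h2 hm, hmt.eventually_ge_atTop 2] with N h3 h4
    exact abs_quadForm_sineWeight_sub_le h4 h3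
  have h3 := h1.add ((continuousAt_limitQ h0).tendsto.comp hm)
  simpa using h3

/-- The relative loss in the Levenshtein bound for `sineWeight m`, which then reads
`M * N * (1 - glbLoss M N K m)`. -/
noncomputable def glbLoss (M N K m : ℕ) : ℝ :=
  (((M : ℝ) * N - 1) / K * (tanSq m / (2 * m)) + quadForm N (sineWeight m) 0 / N) /
    (1 - 1 / (K : ℝ) * (tanSq m / (2 * m)))

theorem glb_sineWeight {M N K m : ℕ} (hN : 0 < N) (hm : 2 ≤ m) (hmN : m ≤ 2 * N - 1) :
    glb M N K (sineWeight m) = (M : ℝ) * N * (1 - glbLoss M N K m) := by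
  have hN' : (N : ℝ) ≠ 0 := by exact_mod_cast hN.ne'
  have e : quadForm N (sineWeight m) ((N : ℝ) * ((M : ℝ) * N - 1) / K) =
      N * (((M : ℝ) * N - 1) / K * (tanSq m / (2 * m)) + quadForm N (sineWeight m) 0 / N) := by
    rw [mul_add, mul_div_cancel₀ _ hN', quadForm, quadForm, zero_mul, zero_add,
      sum_sineWeight_sq hm hmN]
    ring
  rw [glb, e, sum_sineWeight_sq hm hmN, glbLoss, mul_div_assoc]
  ring

theorem tendsto_glbLoss {M K : ℕ} {r : ℝ} (h0 : 0 < r) (h2 : r < 2) {m : ℕ → ℕ}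
    (hm : Tendsto (fun N : ℕ => (m N : ℝ) / N) atTop (𝓝 r)) :
    Tendsto (fun N : ℕ => glbLoss M N K (m N)) atTop (𝓝 (limitLoss M K r)) := by
  have hmt := tendsto_atTop_of_div_tendsto h0 hm
  have hQ := tendsto_quadForm_sineWeight h0 h2 hm
  have hα := tendsto_tanSq.comp hmt
  have hσ : Tendsto (fun N : ℕ => tanSq (m N) / (2 * (m N : ℝ))) atTop (𝓝 0) := by
    have h3 := hα.mul ((tendsto_const_div_atTop_nhds_zero_nat (1 / 2)).comp hmt)
    rw [mul_zero] at h3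
    refine h3.congr fun N => ?_
    simp only [Function.comp]
    rw [div_div, mul_one_div]
  have hinv : Tendsto (fun N : ℕ => 1 / (2 * ((m N : ℝ) / N))) atTop (𝓝 (1 / (2 * r))) :=
    tendsto_const_nhds.div (hm.const_mul 2) (by positivity)
  have hfirst : Tendsto (fun N : ℕ => ((M : ℝ) * N - 1) / K * (tanSq (m N) / (2 * (m N : ℝ))))
      atTop (𝓝 (M / K * (Real.pi ^ 2 / 4 * (1 / (2 * r))) - 1 / K * 0)) := by
    have h3 := ((hα.mul hinv).const_mul ((M : ℝ) / K)).sub (hσ.const_mul (1 / (K : ℝ)))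
    refine h3.congr' ?_
    filter_upwards [eventually_gt_atTop 0, hmt.eventually_gt_atTop 0] with N hN hmN
    have h4 : (N : ℝ) ≠ 0 := by exact_mod_cast hN.ne'
    have h5 : (m N : ℝ) ≠ 0 := by exact_mod_cast hmN.ne'
    simp only [Function.comp]
    have e : 1 / (2 * ((m N : ℝ) / N)) = N * (1 / (2 * (m N : ℝ))) := by field_simp
    rw [e]
    ring
  have h3 := (hfirst.add hQ).div ((hσ.const_mul (1 / (K : ℝ))).const_sub 1) (by norm_num)
  refine h3.trans (le_of_eq ?_)
  congr 1
  unfold limitLoss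
  rw [mul_zero, sub_zero, sub_zero, div_one]
  congr 1
  have := h0.ne'
  by_cases hK : (K : ℝ) = 0
  · simp [hK]
  · field_simp
    ring

theorem tendsto_floor_mul_div {r : ℝ} (h0 : 0 < r) :
    Tendsto (fun N : ℕ => ((⌊r * N⌋₊ : ℕ) : ℝ) / N) atTop (𝓝 r) :=
  (tendsto_nat_floor_mul_div_atTop (R := ℝ) h0.le).comp tendsto_natCast_atTop_atTop

theorem limitQ_ge {r : ℝ} (h0 : 0 < r) (h2 : r < 2) : -3 ≤ limitQ r := by
  unfold limitQ
  split_ifs with h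
  · linarith
  · push Not at h
    have h1 : -1 ≤ (r - 1) / 2 * Real.cos (Real.pi / r) := by
      have := Real.neg_one_le_cos (Real.pi / r)
      nlinarith
    have h3 : 0 ≤ Real.sin (Real.pi / r) :=
      Real.sin_nonneg_of_nonneg_of_le_pi (by positivity) (div_le_self Real.pi_pos.le h.le)
    have h4 : 0 ≤ 3 * r / (2 * Real.pi) * Real.sin (Real.pi / r) := by positivity
    linarith

theorem bddBelow_limitLoss (M K : ℕ) : BddBelow (limitLoss M K '' Set.Ioo 0 2) := by
  refine ⟨-3, ?_⟩
  rintro _ ⟨r, ⟨h0, h2⟩, rfl⟩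
  have := limitQ_ge h0 h2
  have : 0 ≤ (M : ℝ) * Real.pi ^ 2 / (8 * (K : ℝ) * r) := by positivity
  unfold limitLoss
  linarith

theorem one_sub_limitLoss_le {M K : ℕ} {r : ℝ} (h0 : 0 < r) (h2 : r < 2) :
    1 - limitLoss M K r ≤ limitFactor M K := by
  unfold limitFactor
  have := csInf_le (bddBelow_limitLoss M K) ⟨r, ⟨h0, h2⟩, rfl⟩
  linarith

theorem exists_lt_one_sub_limitLoss {M K : ℕ} {y : ℝ} (hy : y < limitFactor M K) :
    ∃ r : ℝ, 0 < r ∧ r < 2 ∧ y < 1 - limitLoss M K r := by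
  unfold limitFactor at hy
  obtain ⟨_, ⟨r, hr, rfl⟩, h⟩ := exists_lt_of_csInf_lt (s := limitLoss M K '' Set.Ioo 0 2)
    ⟨_, 1, ⟨by norm_num, by norm_num⟩, rfl⟩ (show _ < 1 - y by linarith)
  exact ⟨r, hr.1, hr.2, by linarith⟩

/-- No choice of `m` beats the limit factor asymptotically. For large `m` the error `quadErr m` is
small; for bounded `m` the term `(MN - 1) π² / (8Km)` alone makes the loss exceed any bound. -/
theorem eventually_one_sub_glbLoss_le (M K : ℕ) (hM : 1 ≤ M) (hK : 2 ≤ K) {ε : ℝ} (hε : 0 < ε) :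
    ∀ᶠ N : ℕ in atTop, ∀ m : ℕ, 2 ≤ m → m ≤ 2 * N - 1 →
      1 - glbLoss M N K m ≤ limitFactor M K + ε := by
  have hK' : (2 : ℝ) ≤ K := by exact_mod_cast hK
  have hM' : (1 : ℝ) ≤ M := by exact_mod_cast hM
  have hlim : Tendsto (fun m : ℕ => quadErr m + Real.pi ^ 2 / (8 * K) / m) atTop (𝓝 0) := by
    have := tendsto_quadErr.add (tendsto_const_div_atTop_nhds_zero_nat (Real.pi ^ 2 / (8 * K)))
    simpa using this
  obtain ⟨m₁, hm₁⟩ := eventually_atTop.1 (hlim.eventually (gt_mem_nhds hε))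
  have hbig : Tendsto (fun N : ℕ => ((M : ℝ) * N - 1) * (Real.pi ^ 2 / (8 * K * (m₁ + 1))))
      atTop atTop := by
    refine Tendsto.atTop_mul_const (by positivity) ?_
    refine tendsto_atTop_add_const_right _ _ ?_
    exact Tendsto.const_mul_atTop (by linarith) tendsto_natCast_atTop_atTop
  filter_upwards [hbig.eventually_ge_atTop (1 - limitFactor M K), eventually_gt_atTop 0]
    with N hN hN0 m hm hmN
  have hm' : (0 : ℝ) < m := by exact_mod_cast (by omega : 0 < m)
  have hN' : (1 : ℝ) ≤ N := by exact_mod_cast hN0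
  have hMN : 0 ≤ (M : ℝ) * N - 1 := by nlinarith
  have hα := pi_sq_div_four_le_tanSq hm
  have hQ := quadForm_sineWeight_zero_nonneg (N := N) hm
  have hσ1 := sum_sineWeight_sq_le_one hm hmN
  rw [sum_sineWeight_sq hm hmN] at hσ1
  have hσ0 : Real.pi ^ 2 / (8 * m) ≤ tanSq m / (2 * m) := by
    calc Real.pi ^ 2 / (8 * m) = Real.pi ^ 2 / 4 / (2 * m) := by field_simp; ring
      _ ≤ _ := by gcongr
  have hσ0' : 0 ≤ tanSq m / (2 * m) := le_trans (by positivity) hσ0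
  have hden1 : 1 - 1 / (K : ℝ) * (tanSq m / (2 * m)) ≤ 1 := by
    have : 0 ≤ 1 / (K : ℝ) * (tanSq m / (2 * m)) := by positivity
    linarith
  have hden0 : 0 < 1 - 1 / (K : ℝ) * (tanSq m / (2 * m)) := by
    have h1 : 1 / (K : ℝ) ≤ 1 / 2 := one_div_le_one_div_of_le (by norm_num) hK'
    have h2 := mul_le_mul h1 hσ1 hσ0' (by norm_num)
    linarith
  have hfirst : ((M : ℝ) * N - 1) / K * (Real.pi ^ 2 / (8 * m)) ≤
      ((M : ℝ) * N - 1) / K * (tanSq m / (2 * m)) :=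
    mul_le_mul_of_nonneg_left hσ0 (by positivity)
  have hQN : 0 ≤ quadForm N (sineWeight m) 0 / N := by positivity
  have hfirst0 : 0 ≤ ((M : ℝ) * N - 1) / K * (Real.pi ^ 2 / (8 * m)) := by positivity
  have hloss : ((M : ℝ) * N - 1) / K * (Real.pi ^ 2 / (8 * m)) +
      quadForm N (sineWeight m) 0 / N ≤ glbLoss M N K m := by
    unfold glbLoss
    rw [le_div_iff₀ hden0]
    calc _ ≤ (((M : ℝ) * N - 1) / K * (Real.pi ^ 2 / (8 * m)) +
          quadForm N (sineWeight m) 0 / N) * 1 :=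
          mul_le_mul_of_nonneg_left hden1 (by positivity)
      _ ≤ _ := by linarith
  rcases le_total m₁ m with hcase | hcase
  · have herr := hm₁ m hcase
    have hq := abs_le.1 (abs_quadForm_sineWeight_sub_le hm hmN)
    have h0 : 0 < (m : ℝ) / N := by positivity
    have h2 : (m : ℝ) / N < 2 := by
      rw [div_lt_iff₀ (by linarith)]
      exact_mod_cast (by omega : m < 2 * N)
    have hB := one_sub_limitLoss_le (M := M) (K := K) h0 h2
    have e : limitLoss M K ((m : ℝ) / N) = ((M : ℝ) * N - 1) / K * (Real.pi ^ 2 / (8 * m)) +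
        Real.pi ^ 2 / (8 * K) / m + limitQ ((m : ℝ) / N) := by
      unfold limitLoss
      field_simp
      ring
    linarith [hq.1]
  · have h3 : ((M : ℝ) * N - 1) * (Real.pi ^ 2 / (8 * K * (m₁ + 1))) ≤
        ((M : ℝ) * N - 1) / K * (Real.pi ^ 2 / (8 * m)) := by
      have hc : (m : ℝ) ≤ m₁ + 1 := by
        have : (m : ℝ) ≤ m₁ := by exact_mod_cast hcase
        linarith
      calc _ ≤ ((M : ℝ) * N - 1) * (Real.pi ^ 2 / (8 * K * m)) := by gcongr
        _ = _ := by field_simp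
    linarith

theorem tendsto_sineGLB (M K : ℕ) (hM : 1 ≤ M) (hK : 2 ≤ K) :
    Tendsto (fun N : ℕ => sineGLB M N K / ((M : ℝ) * N)) atTop (𝓝 (limitFactor M K)) := by
  have key : ∀ N : ℕ, 2 ≤ N → ∀ y : ℝ, (∀ m, 2 ≤ m → m ≤ 2 * N - 1 → 1 - glbLoss M N K m ≤ y) →
      sineGLB M N K / ((M : ℝ) * N) ≤ y := by
    intro N hN y hy
    have hMN : (0 : ℝ) < M * N := by
      exact_mod_cast Nat.mul_pos (by omega : 0 < M) (by omega : 0 < N)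
    rw [div_le_iff₀ hMN, sineGLB]
    refine csSup_le ⟨_, 2, ⟨le_rfl, by omega⟩, rfl⟩ ?_
    rintro _ ⟨m, ⟨h1, h2⟩, rfl⟩
    dsimp only
    rw [glb_sineWeight (by omega) h1 h2, mul_comm]
    exact mul_le_mul_of_nonneg_right (hy m h1 h2) hMN.le
  have key2 : ∀ N : ℕ, 2 ≤ N → ∀ m, 2 ≤ m → m ≤ 2 * N - 1 →
      1 - glbLoss M N K m ≤ sineGLB M N K / ((M : ℝ) * N) := by
    intro N hN m h1 h2
    have hMN : (0 : ℝ) < M * N := by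
      exact_mod_cast Nat.mul_pos (by omega : 0 < M) (by omega : 0 < N)
    rw [le_div_iff₀ hMN, mul_comm, ← glb_sineWeight (by omega) h1 h2]
    exact le_csSup ((Set.finite_Icc _ _).image _).bddAbove ⟨m, ⟨h1, h2⟩, rfl⟩
  refine tendsto_order.2 ⟨fun y hy => ?_, fun y hy => ?_⟩
  · obtain ⟨r, h0, h2, hr⟩ := exists_lt_one_sub_limitLoss hy
    have hm := tendsto_floor_mul_div h0
    have hL := (tendsto_glbLoss (M := M) (K := K) h0 h2 hm).const_sub 1
    filter_upwards [hL.eventually (lt_mem_nhds hr), eventually_ge_atTop 2,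
      (tendsto_atTop_of_div_tendsto h0 hm).eventually_ge_atTop 2,
      eventually_le_of_div_tendsto h2 hm] with N h3 h4 h5 h6
    exact h3.trans_le (key2 N h4 _ h5 h6)
  · filter_upwards [eventually_one_sub_glbLoss_le M K hM hK
        (ε := (y - limitFactor M K) / 2) (by linarith),
      eventually_ge_atTop 2] with N h3 h4
    refine (key N h4 _ h3).trans_lt (by linarith)

/-- For `K = 1` the denominator of the bound vanishes at `m = 2`, so this is not read off from the
optimized bound: a single sequence `m = ⌊r N⌋` with `r` nearly optimal is used, along which the
squared norm of the weight vector tends to `0`. -/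
theorem eventually_le_deltaMax_sq (M K : ℕ) (hM : 1 ≤ M) (hK : 1 ≤ K) {ε : ℝ} (hε : 0 < ε) :
    ∀ᶠ N : ℕ in atTop, ∀ C : Fin K → Matrix (Fin M) (Fin N) ℂ, OverRootsOfUnity C →
      (M : ℝ) * N * (limitFactor M K - ε) ≤ deltaMax C ^ 2 := by
  obtain ⟨r, h0, h2, hr⟩ := exists_lt_one_sub_limitLoss
    (show limitFactor M K - ε < limitFactor M K by linarith)
  have hm := tendsto_floor_mul_div h0
  have hmt := tendsto_atTop_of_div_tendsto h0 hm
  have hL := (tendsto_glbLoss (M := M) (K := K) h0 h2 hm).const_sub 1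
  have hσ : Tendsto (fun m : ℕ => tanSq m / (2 * (m : ℝ))) atTop (𝓝 0) := by
    have h3 := tendsto_tanSq.mul (tendsto_const_div_atTop_nhds_zero_nat (1 / 2))
    rw [mul_zero] at h3
    refine h3.congr fun N => ?_
    rw [div_div, mul_one_div]
  filter_upwards [hL.eventually (lt_mem_nhds hr), eventually_gt_atTop 0,
      hmt.eventually_ge_atTop 2, eventually_le_of_div_tendsto h2 hm,
      (hσ.comp hmt).eventually (gt_mem_nhds zero_lt_one)] with N h3 h4 h5 h6 h7 C hC
  have hK' : (1 : ℝ) ≤ K := by exact_mod_cast hK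
  refine le_trans ?_ (glb_le_deltaMax_sq (by omega) h4 C hC _ (sineWeight_nonneg h5)
    (sum_sineWeight h5 h6) ?_)
  · rw [glb_sineWeight h4 h5 h6]
    exact mul_le_mul_of_nonneg_left h3.le (by positivity)
  · rw [sum_sineWeight_sq h5 h6]
    exact lt_of_lt_of_le h7 hK'

/-! ### Taylor bounds for sine and cosine -/

/-- The first `n` nonzero terms of the Taylor series of the cosine at `0`. -/
noncomputable def cosTaylor (n : ℕ) (x : ℝ) : ℝ :=
  ∑ k ∈ Finset.range n, (-1) ^ k * x ^ (2 * k) / (Nat.factorial (2 * k) : ℝ)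

/-- The first `n` nonzero terms of the Taylor series of the sine at `0`. -/
noncomputable def sinTaylor (n : ℕ) (x : ℝ) : ℝ :=
  ∑ k ∈ Finset.range n, (-1) ^ k * x ^ (2 * k + 1) / (Nat.factorial (2 * k + 1) : ℝ)

theorem hasDerivAt_pow_div_factorial (n : ℕ) (x : ℝ) :
    HasDerivAt (fun x : ℝ => x ^ (n + 1) / (Nat.factorial (n + 1) : ℝ))
      (x ^ n / (Nat.factorial n : ℝ)) x := by
  refine ((hasDerivAt_pow (n + 1) x).div_const _).congr_deriv ?_
  rw [Nat.factorial_succ]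
  push_cast
  exact mul_div_mul_left _ _ (by positivity)

theorem hasDerivAt_sinTaylor (n : ℕ) (x : ℝ) : HasDerivAt (sinTaylor n) (cosTaylor n x) x := by
  unfold sinTaylor cosTaylor
  refine HasDerivAt.fun_sum fun k _ => ?_
  simp_rw [mul_div_assoc]
  exact (hasDerivAt_pow_div_factorial (2 * k) x).const_mul _

theorem hasDerivAt_cosTaylor_succ (n : ℕ) (x : ℝ) :
    HasDerivAt (cosTaylor (n + 1)) (-sinTaylor n x) x := by
  have e : cosTaylor (n + 1) = fun x => ∑ k ∈ Finset.range n,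
      (-1) ^ (k + 1) * (x ^ (2 * k + 1 + 1) / (Nat.factorial (2 * k + 1 + 1) : ℝ)) + 1 := by
    funext x
    rw [cosTaylor, Finset.sum_range_succ']
    simp [mul_add, mul_div_assoc, add_assoc]
  rw [e, sinTaylor, ← Finset.sum_neg_distrib]
  refine HasDerivAt.add_const _ (HasDerivAt.fun_sum fun k _ => ?_)
  refine ((hasDerivAt_pow_div_factorial (2 * k + 1) x).const_mul _).congr_deriv ?_
  rw [pow_succ]
  ring

theorem nonneg_of_hasDerivAt_nonneg {f f' : ℝ → ℝ} (hf : ∀ x, HasDerivAt f (f' x) x)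
    (h0 : f 0 = 0) (hf' : ∀ x, 0 ≤ x → 0 ≤ f' x) {x : ℝ} (hx : 0 ≤ x) : 0 ≤ f x := by
  have hmono : MonotoneOn f (Set.Ici 0) := by
    refine monotoneOn_of_deriv_nonneg (convex_Ici 0)
      (fun y _ => (hf y).continuousAt.continuousWithinAt)
      (fun y _ => (hf y).differentiableAt.differentiableWithinAt) fun y hy => ?_
    rw [interior_Ici] at hy
    rw [(hf y).deriv]
    exact hf' y (le_of_lt hy)
  rw [← h0]
  exact hmono Set.self_mem_Ici hx hx

/-- On `[0, ∞)` the Taylor sums of sine and cosine lie alternately above and below the function;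
each bound follows from the preceding one by integration. -/
theorem taylor_alternating (n : ℕ) :
    (∀ x : ℝ, 0 ≤ x → 0 ≤ (-1) ^ (n + 1) * (Real.cos x - cosTaylor (n + 1) x)) ∧
      ∀ x : ℝ, 0 ≤ x → 0 ≤ (-1) ^ (n + 1) * (Real.sin x - sinTaylor (n + 1) x) := by
  have hs : ∀ n : ℕ, (∀ x : ℝ, 0 ≤ x → 0 ≤ (-1) ^ (n + 1) * (Real.cos x - cosTaylor (n + 1) x)) →
      ∀ x : ℝ, 0 ≤ x → 0 ≤ (-1) ^ (n + 1) * (Real.sin x - sinTaylor (n + 1) x) := by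
    intro n hc x hx
    refine nonneg_of_hasDerivAt_nonneg (f := fun x => (-1) ^ (n + 1) *
      (Real.sin x - sinTaylor (n + 1) x))
      (fun y => ((Real.hasDerivAt_sin y).sub (hasDerivAt_sinTaylor (n + 1) y)).const_mul _)
      ?_ hc hx
    simp [sinTaylor]
  induction n with
  | zero =>
    have h0 : ∀ x : ℝ, 0 ≤ x → 0 ≤ (-1) ^ (0 + 1) * (Real.cos x - cosTaylor (0 + 1) x) := by
      intro x _
      simp [cosTaylor, Real.cos_le_one]
    exact ⟨h0, hs 0 h0⟩
  | succ n ih =>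
    have h1 : ∀ x : ℝ, 0 ≤ x →
        0 ≤ (-1) ^ (n + 1 + 1) * (Real.cos x - cosTaylor (n + 1 + 1) x) := by
      intro x hx
      refine nonneg_of_hasDerivAt_nonneg (f := fun x => (-1) ^ (n + 1 + 1) *
        (Real.cos x - cosTaylor (n + 1 + 1) x))
        (f' := fun x => (-1) ^ (n + 1) * (Real.sin x - sinTaylor (n + 1) x))
        (fun y => (((Real.hasDerivAt_cos y).sub (hasDerivAt_cosTaylor_succ (n + 1) y)).const_mul
          _).congr_deriv ?_) ?_ ih.2 hx
      · rw [pow_succ _ (n + 1)]; ring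
      · simp [cosTaylor, Finset.sum_range_succ']
    exact ⟨h1, hs _ h1⟩

/-! ### The sign of the gap to the Welch bound -/

/-- With `x = M / K`, the difference between `limitLoss M K r` and `1 / 2 + x / 2`, the loss at
which the bound would equal the limit `(1 - x) / 2` of the normalized Welch bound. -/
noncomputable def lossGap (x r : ℝ) : ℝ := x * Real.pi ^ 2 / (8 * r) + limitQ r - (1 / 2 + x / 2)

/-- `lossGap x r` times `π / r`, in the variable `φ = π - π / r`, for which the relevant range
`1 < r < 2` becomes `0 < φ < π / 2`. -/
noncomputable def angleGap (x φ : ℝ) : ℝ :=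
  x * Real.pi / 8 * (Real.pi - φ) ^ 2 + (1 / 2 - x / 2) * (Real.pi - φ) - 3 * Real.pi / 4 -
    φ / 2 * Real.cos φ + 3 / 2 * Real.sin φ

theorem lossGap_mul_angle {x φ : ℝ} (h0 : 0 < φ) (h1 : φ < Real.pi) :
    lossGap x (Real.pi / (Real.pi - φ)) * (Real.pi - φ) = angleGap x φ := by
  have hp := Real.pi_pos
  have hθ : 0 < Real.pi - φ := by linarith
  have hr : ¬ Real.pi / (Real.pi - φ) ≤ 1 := by rw [div_le_one hθ]; linarith
  unfold lossGap limitQ angleGap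
  rw [if_neg hr, div_div_cancel₀ hp.ne', Real.cos_pi_sub, Real.sin_pi_sub]
  field_simp
  ring

/-- The gap increases in `x` because `r < 2 < π² / 4`, so a single ratio decides the sign for all
smaller, respectively larger, ones. -/
theorem lossGap_mono {x y r : ℝ} (h0 : 0 < r) (h2 : r < 2) (hxy : x ≤ y) :
    lossGap x r ≤ lossGap y r := by
  have hp := Real.pi_gt_three
  have h : 1 / 2 ≤ Real.pi ^ 2 / (8 * r) := by
    rw [div_le_div_iff₀ (by norm_num) (by positivity)]; nlinarith
  have e : ∀ z, lossGap z r = z * (Real.pi ^ 2 / (8 * r) - 1 / 2) + (limitQ r - 1 / 2) := by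
    intro z; unfold lossGap; ring
  rw [e, e]
  have := mul_le_mul_of_nonneg_right hxy (sub_nonneg.2 h)
  linarith

/-- At the ratio `60 / 149`, attained by `M = 60` and `K = 149`, the Welch bound is beaten. The
margin is about `4 · 10⁻⁶`; the gap is evaluated close to its minimum, at `φ = 1.105`. -/
theorem exists_lossGap_neg : ∃ r : ℝ, 0 < r ∧ r < 2 ∧ lossGap (60 / 149) r < 0 := by
  have hp1 := Real.pi_gt_d6
  have hp2 := Real.pi_lt_d6
  have hθ : 0 < Real.pi - 1.105 := by linarith
  refine ⟨Real.pi / (Real.pi - 1.105), by positivity, by rw [div_lt_iff₀ hθ]; linarith, ?_⟩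
  have hs := (taylor_alternating 4).2 1.105 (by norm_num)
  have hc := (taylor_alternating 5).1 1.105 (by norm_num)
  simp only [sinTaylor, cosTaylor, Finset.sum_range_succ, Finset.sum_range_zero] at hs hc
  norm_num [Nat.factorial] at hs hc
  have h := lossGap_mul_angle (x := 60 / 149) (φ := 1.105) (by norm_num) (by linarith)
  have hG : angleGap (60 / 149) 1.105 < 0 := by
    unfold angleGap
    have h1 : Real.pi * (Real.pi - 1.105) ^ 2 ≤ 3.141593 * (3.141593 - 1.105) ^ 2 := by
      gcongr
    norm_num at *
    linarith
  by_contra hcon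
  push Not at hcon
  have := mul_nonneg hcon hθ.le
  linarith

/-- At the ratio `29 / 72`, attained by `M = 29` and `K = 72`, no weight parameter beats the Welch
bound. -/
theorem lossGap_nonneg {r : ℝ} (h0 : 0 < r) (h2 : r < 2) : 0 ≤ lossGap (29 / 72) r := by
  have hp1 := Real.pi_gt_d6
  have hp2 := Real.pi_lt_d6
  rcases le_or_gt r 1 with h1 | h1
  · unfold lossGap limitQ
    rw [if_pos h1]
    have hsq : 3.141592 ^ 2 ≤ Real.pi ^ 2 := by gcongr
    have : 29 / 72 / 2 + 1 / 2 - r / 4 ≤ 29 / 72 * Real.pi ^ 2 / (8 * r) := by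
      rw [le_div_iff₀ (by positivity)]
      nlinarith
    linarith
  · set t := Real.pi - Real.pi / r with ht
    have hpr : Real.pi / r < Real.pi := div_lt_self (by linarith) h1
    have hpr2 : Real.pi / 2 < Real.pi / r := div_lt_div_of_pos_left Real.pi_pos h0 h2
    have ht0 : 0 < t := by linarith
    have ht1 : t ≤ 1.571 := by linarith
    have hr : r = Real.pi / (Real.pi - t) := by
      rw [ht, sub_sub_cancel, div_div_cancel₀ Real.pi_ne_zero]
    have h := lossGap_mul_angle (x := 29 / 72) ht0 (by linarith)
    rw [← hr] at h
    have hs := (taylor_alternating 3).2 t ht0.le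
    have hc := (taylor_alternating 4).1 t ht0.le
    simp only [sinTaylor, cosTaylor, Finset.sum_range_succ, Finset.sum_range_zero] at hs hc
    norm_num [Nat.factorial] at hs hc
    have hct := mul_le_mul_of_nonneg_left hc ht0.le
    have ha : 3.141592 * (3.141592 - t) ^ 2 ≤ Real.pi * (Real.pi - t) ^ 2 := by
      gcongr
      linarith
    have b2 : t ^ 2 ≤ 1.571 ^ 2 := by gcongr
    have b3 : t ^ 3 ≤ 1.571 ^ 3 := by gcongr
    -- With Taylor bounds for sine and cosine, `angleGap` is bounded below by a polynomial in `t`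
    -- that attains its minimum, about `4 · 10⁻⁵`, near `1.1065`. Up to rounding and that positive
    -- remainder it is `(t - 1.1065)²` times the polynomial assembled from the two factors below.
    have hq1 : 0 ≤ 0.11676033 - 0.027793637 * t - 0.016414706 * t ^ 2 - 0.006968728 * t ^ 3 := by
      linarith
    have hq2 : 0 ≤ 0.000810975 + 0.000351277 * t - 0.000027443 * t ^ 2 - 0.000012401 * t ^ 3 := by
      linarith
    have hq := mul_nonneg (sq_nonneg (t - 1.1065))
      (add_nonneg hq1 (mul_nonneg (pow_nonneg ht0.le 4) hq2))
    have hpow : ∀ k : ℕ, 0 ≤ t ^ k ∧ t ^ k ≤ 1.571 ^ k := fun k =>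
      ⟨pow_nonneg ht0.le k, pow_le_pow_left₀ ht0.le ht1 k⟩
    have hG : 0 ≤ angleGap (29 / 72) t := by
      unfold angleGap
      have p4 := hpow 4
      have p5 := hpow 5
      have p6 := hpow 6
      have p7 := hpow 7
      have p8 := hpow 8
      have p9 := hpow 9
      have p3 := hpow 3
      have p2 := hpow 2
      norm_num at *
      linarith
    by_contra hcon
    push Not at hcon
    have := mul_neg_of_neg_of_pos hcon (show 0 < Real.pi - t by linarith)
    linarith

/-! ### The threshold `Kbar` and attainment of the infimum -/

theorem tendsto_kbarArg (M : ℕ) : Tendsto (fun N : ℕ => 4 * ((M : ℝ) * N - 1) * N *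
    Real.sin (Real.pi / (2 * (2 * (N : ℝ) - 1))) ^ 2) atTop (𝓝 (M * Real.pi ^ 2 / 4)) := by
  have h : HasDerivAt Real.sin 1 0 := by simpa using Real.hasDerivAt_sin 0
  have hL : Tendsto (fun N : ℕ => 2 * N - 1) atTop atTop :=
    tendsto_atTop_mono (fun N => by change N - 1 ≤ 2 * N - 1; omega) (tendsto_sub_atTop_nat 1)
  have h1 := (tendsto_nat_mul_comp_div h Real.sin_zero (Real.pi / 2)).comp hL
  have h2 : Tendsto (fun N : ℕ => (1 : ℝ) / N) atTop (𝓝 0) :=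
    tendsto_const_div_atTop_nhds_zero_nat 1
  have h3 := (((h2.const_sub (M : ℝ)).const_mul 4).mul (h1.pow 2)).mul
    (((h2.const_sub 2).inv₀ (by norm_num)).pow 2)
  have e : 4 * ((M : ℝ) - 0) * (Real.pi / 2 * 1) ^ 2 * ((2 - 0 : ℝ)⁻¹) ^ 2 =
    M * Real.pi ^ 2 / 4 := by ring
  rw [e] at h3
  refine h3.congr' ?_
  filter_upwards [eventually_gt_atTop 0] with N hN
  have hN' : (1 : ℝ) ≤ N := by exact_mod_cast hN
  have hc : ((2 * N - 1 : ℕ) : ℝ) = 2 * N - 1 := by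
    rw [Nat.cast_sub (by omega)]; push_cast; ring
  have hd : 2 * (N : ℝ) - 1 ≠ 0 := by linarith
  have e2 : (2 - 1 / (N : ℝ))⁻¹ = N / (2 * N - 1) := by
    rw [← inv_div]; field_simp
  simp only [Function.comp, hc, e2, div_div]
  generalize 2 * (N : ℝ) - 1 = L at hd
  field_simp

theorem le_of_eventually_kbar_lt {M K : ℕ} (h : ∀ᶠ N : ℕ in atTop, Kbar M N + 1 ≤ K) :
    (M : ℝ) * Real.pi ^ 2 / 4 ≤ K := by
  refine le_of_tendsto (tendsto_kbarArg M) ?_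
  filter_upwards [h] with N hN
  have h1 : ((Kbar M N + 1 : ℕ) : ℝ) ≤ K := Nat.cast_le.2 hN
  refine (Nat.lt_floor_add_one _).le.trans ?_
  rwa [Nat.cast_add, Nat.cast_one] at h1

theorem eventually_kbar_lt {M K : ℕ} (hK : K ≠ 0) (h : (M : ℝ) * Real.pi ^ 2 / 4 < K) :
    ∀ᶠ N : ℕ in atTop, Kbar M N + 1 ≤ K := by
  filter_upwards [(tendsto_kbarArg M).eventually (gt_mem_nhds h)] with N hN
  exact (Nat.floor_lt' hK).2 hN

theorem eventually_le_kbar {M k : ℕ} (h : (k : ℝ) < (M : ℝ) * Real.pi ^ 2 / 4) :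
    ∀ᶠ N : ℕ in atTop, k ≤ Kbar M N := by
  filter_upwards [(tendsto_kbarArg M).eventually (lt_mem_nhds h)] with N hN
  exact Nat.le_floor hN.le

/-- This keeps the minimum of the loss away from `r = 2`; the summand `1 / 12` is what the first
term of the loss can gain between `3 / 2` and `2` when `K ≥ M π² / 4`. The local slope at `2` does
not suffice: it is negative when `K` is close to `M π² / 4`. -/
theorem limitQ_three_halves_add_lt : limitQ (3 / 2) + 1 / 12 < limitQ 2 := by
  have hp := Real.pi_pos
  have hp2 := Real.pi_lt_d4
  unfold limitQ
  rw [if_neg (by norm_num), if_neg (by norm_num), Real.cos_pi_div_two, Real.sin_pi_div_two,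
    show Real.pi / (3 / 2) = Real.pi - Real.pi / 3 by ring, Real.cos_pi_sub, Real.sin_pi_sub,
    Real.cos_pi_div_three, Real.sin_pi_div_three]
  have h3 : √3 < 1.7321 := by
    rw [Real.sqrt_lt' (by norm_num)]; norm_num
  have key : 1 / 3 < (3 - 9 * √3 / 8) / Real.pi := by
    rw [lt_div_iff₀ hp]; linarith
  have e : (3 - 9 * √3 / 8) / Real.pi = 3 * 2 / (2 * Real.pi) * 1 -
      3 * (3 / 2) / (2 * Real.pi) * (√3 / 2) := by
    field_simp
    ring
  linarith

theorem limitQ_two_lt : limitQ 2 < 1 := by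
  have hp := Real.pi_gt_three
  unfold limitQ
  rw [if_neg (by norm_num), Real.cos_pi_div_two, Real.sin_pi_div_two]
  have : 3 * 2 / (2 * Real.pi) ≤ 1 := by rw [div_le_one (by positivity)]; linarith
  linarith

/-- The loss blows up at `0` and is smaller at `3 / 2` than at `2`, so its minimum over a compact
interval `[δ, 2]` lies in the open interval `(0, 2)`. -/
theorem exists_isMinOn_limitLoss {M K : ℕ} (hM : 0 < M) (hMK : (M : ℝ) * Real.pi ^ 2 / 4 ≤ K) :
    ∃ r ∈ Set.Ioo (0 : ℝ) 2, IsMinOn (limitLoss M K) (Set.Ioo 0 2) r := by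
  have hp := Real.pi_pos
  have hM' : (0 : ℝ) < M := by exact_mod_cast hM
  have hK' : (0 : ℝ) < K := lt_of_lt_of_le (by positivity) hMK
  set c : ℝ := M * Real.pi ^ 2 / (8 * K) with hc
  have hc0 : 0 < c := by positivity
  have hc1 : c ≤ 1 / 2 := by
    rw [hc, div_le_iff₀ (by positivity)]; linarith
  have e : ∀ r, limitLoss M K r = c / r + limitQ r := by
    intro r; unfold limitLoss; rw [hc, div_div]
  have h32 : limitLoss M K (3 / 2) < limitLoss M K 2 := by
    rw [e, e]
    have := limitQ_three_halves_add_lt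
    linarith
  have h32' : limitLoss M K (3 / 2) < 2 := by
    refine h32.trans ?_
    rw [e]
    linarith [limitQ_two_lt]
  -- For `r < c / 2` the term `c / r` alone exceeds `2`, hence the loss at `3 / 2`.
  have hcont : ContinuousOn (limitLoss M K) (Set.Icc (c / 2) 2) := by
    intro r hr
    have hr0 : 0 < r := by linarith [hr.1]
    have : limitLoss M K = fun r => c / r + limitQ r := funext e
    rw [this]
    exact ((continuousAt_const.div continuousAt_id hr0.ne').add
      (continuousAt_limitQ hr0)).continuousWithinAt
  obtain ⟨r, hr, hmin⟩ := isCompact_Icc.exists_isMinOn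
    (⟨3 / 2, by constructor <;> linarith⟩ : (Set.Icc (c / 2) 2).Nonempty) hcont
  have hr32 : limitLoss M K r ≤ limitLoss M K (3 / 2) := hmin ⟨by linarith, by norm_num⟩
  have hr2 : r ≠ 2 := by
    rintro rfl
    linarith
  refine ⟨r, ⟨by linarith [hr.1], lt_of_le_of_ne hr.2 hr2⟩, ?_⟩
  intro y hy
  rcases le_or_gt (c / 2) y with h | h
  · exact hmin ⟨h, hy.2.le⟩
  · have h1 : 2 ≤ c / y := by rw [le_div_iff₀ hy.1]; linarith
    have h2 : 0 ≤ limitQ y := by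
      unfold limitQ
      rw [if_pos (by linarith)]
      linarith [hy.1]
    change limitLoss M K r ≤ limitLoss M K y
    rw [e y]
    linarith

/-! ### Comparison with the Welch bound -/

theorem limitLoss_eq_lossGap (M K : ℕ) (r : ℝ) :
    limitLoss M K r = lossGap ((M : ℝ) / K) r + (1 / 2 + (M : ℝ) / K / 2) := by
  unfold limitLoss lossGap
  rw [sub_add_cancel]
  congr 1
  rw [div_mul_eq_mul_div, div_div]
  ring

theorem welchBound_eq {M N K : ℕ} (hM : 0 < M) : welchBound M N K =
    (M : ℝ) * N * (N * ((K : ℝ) - M) / (K * (2 * (N : ℝ) - 1) - 1)) := by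
  have : (M : ℝ) ≠ 0 := by exact_mod_cast hM.ne'
  unfold welchBound
  field_simp

/-- If every `K ≥ k + 1` has `M / K ≤ 60 / 149`, the Welch bound is beaten with one threshold
for `N` that serves all `K` at once. -/
theorem eventually_welchBound_lt {M k : ℕ} (hM : 0 < M)
    (hk : (k : ℝ) < (M : ℝ) * Real.pi ^ 2 / 4) (hk' : 149 * M ≤ 60 * (k + 1)) :
    ∀ᶠ N : ℕ in atTop, ∀ K : ℕ, Kbar M N + 1 ≤ K →
      welchBound M N K < (M : ℝ) * N * limitFactor M K := by
  obtain ⟨r, h0, h2, hr⟩ := exists_lossGap_neg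
  have hlim : Tendsto (fun N : ℕ => (1 / 2 : ℝ) / N) atTop (𝓝 0) :=
    tendsto_const_div_atTop_nhds_zero_nat _
  -- The Welch bound exceeds its limit by less than `1 / (2 (N - 1))`, uniformly in `K`.
  have hlim' := hlim.comp (tendsto_sub_atTop_nat 1)
  filter_upwards [eventually_le_kbar hk, eventually_ge_atTop 2,
    hlim'.eventually (gt_mem_nhds (neg_pos.2 hr))] with N hN hN2 hη K hK
  have hM' : (0 : ℝ) < M := by exact_mod_cast hM
  have hK1 : (1 : ℝ) ≤ K := by exact_mod_cast (by omega : 1 ≤ K)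
  have hN' : (2 : ℝ) ≤ N := by exact_mod_cast hN2
  have hx : (M : ℝ) / K ≤ 60 / 149 := by
    rw [div_le_div_iff₀ (by linarith) (by norm_num)]
    exact_mod_cast (by omega : M * 149 ≤ 60 * K)
  have hMK : (M : ℝ) ≤ K := by exact_mod_cast (by omega : M ≤ K)
  rw [welchBound_eq hM]
  refine mul_lt_mul_of_pos_left ?_ (by positivity)
  have hB := one_sub_limitLoss_le (M := M) (K := K) h0 h2
  rw [limitLoss_eq_lossGap] at hB
  have hg := lossGap_mono h0 h2 hx
  simp only [Function.comp, Nat.cast_sub (by omega : 1 ≤ N), Nat.cast_one] at hη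
  have h3 : N * ((K : ℝ) - M) / (K * (2 * (N : ℝ) - 1) - 1) ≤
      N * ((K : ℝ) - M) / (K * (2 * (N - 1))) := by
    refine div_le_div_of_nonneg_left (mul_nonneg (by linarith) (by linarith)) ?_ ?_
    · have : (0 : ℝ) < N - 1 := by linarith
      positivity
    · linarith
  have h4 : N * ((K : ℝ) - M) / (K * (2 * (N - 1))) =
      (1 - (M : ℝ) / K) / 2 + (1 / 2) / (N - 1) * (1 - M / K) := by
    have : (N : ℝ) - 1 ≠ 0 := by linarith
    field_simp
    ring
  have h5 : (1 / 2 : ℝ) / (N - 1) * (1 - M / K) ≤ (1 / 2) / (N - 1) * 1 := by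
    refine mul_le_mul_of_nonneg_left ?_ (div_nonneg (by norm_num) (by linarith))
    have : 0 ≤ (M : ℝ) / K := by positivity
    linarith
  linarith

theorem limitFactor_le_of_ratio_ge {M K : ℕ} (hK : 0 < K) (h : 29 * K ≤ 72 * M) :
    limitFactor M K ≤ (1 - (M : ℝ) / K) / 2 := by
  have hK' : (0 : ℝ) < K := by exact_mod_cast hK
  have hx : (29 / 72 : ℝ) ≤ M / K := by
    rw [div_le_div_iff₀ (by norm_num) hK']
    exact_mod_cast (by omega : 29 * K ≤ M * 72)
  have : 1 / 2 + (M : ℝ) / K / 2 ≤ sInf (limitLoss M K '' Set.Ioo 0 2) := by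
    refine le_csInf ⟨_, 1, ⟨by norm_num, by norm_num⟩, rfl⟩ ?_
    rintro _ ⟨r, ⟨h0, h2⟩, rfl⟩
    rw [limitLoss_eq_lossGap]
    linarith [lossGap_mono h0 h2 hx, lossGap_nonneg h0 h2]
  unfold limitFactor
  linarith

/-- The normalized Welch bound lies above its limit `(1 - M / K) / 2`. -/
theorem le_welchBound {M N K : ℕ} (hM : 0 < M) (hMK : M ≤ K) (hN : 2 ≤ N) :
    (M : ℝ) * N * ((1 - (M : ℝ) / K) / 2) ≤ welchBound M N K := by
  have hM' : (0 : ℝ) < M := by exact_mod_cast hM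
  have hMK' : (M : ℝ) ≤ K := by exact_mod_cast hMK
  have hK1 : (1 : ℝ) ≤ K := by exact_mod_cast (by omega : 1 ≤ K)
  have hN' : (2 : ℝ) ≤ N := by exact_mod_cast hN
  rw [welchBound_eq hM]
  refine mul_le_mul_of_nonneg_left ?_ (by positivity)
  have e : (1 - (M : ℝ) / K) / 2 = N * ((K : ℝ) - M) / (K * (2 * N)) := by
    field_simp
  rw [e]
  refine div_le_div_of_nonneg_left (mul_nonneg (by linarith) (by linarith)) ?_ ?_
  · nlinarith
  · nlinarith

/-- The number `⌈149 M / 60⌉ - 1` is less than `M π² / 4` for each `M` in the set, so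
`K ≥ Kbar + 1` forces `M / K ≤ 60 / 149`; here `24672 / 10000 < π² / 4`. -/
theorem goodM_spec : ∀ M ∈ goodM, 10000 * ((149 * M + 59) / 60 - 1) < 24672 * M := by
  decide

/-- For the remaining `M`, the number `K = ⌊72 M / 29⌋` exceeds `M π² / 4`, so that it is admissible
although `M / K ≥ 29 / 72`; here `π² / 4 < 24675 / 10000`. From `M = 66` on, the difference between
`72 / 29` and `π² / 4` outweighs the rounding. -/
theorem not_goodM_spec {M : ℕ} (hM : 2 ≤ M) (h : M ∉ goodM) :
    24675 * M < 10000 * (72 * M / 29) := by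
  rcases lt_or_ge M 66 with h1 | h1
  · revert h
    interval_cases M <;> decide
  · omega

theorem exists_not_welchBound_lt {M : ℕ} (hM : 2 ≤ M) (h : M ∉ goodM) :
    ∃ K : ℕ, (∀ᶠ N : ℕ in atTop, Kbar M N + 1 ≤ K) ∧
      ¬ ∀ᶠ N : ℕ in atTop, welchBound M N K < (M : ℝ) * N * limitFactor M K := by
  have hs := not_goodM_spec hM h
  set K := 72 * M / 29 with hK
  have hs' : (24675 : ℝ) * M < 10000 * K := by exact_mod_cast hs
  have hpi : Real.pi ^ 2 ≤ 3.141593 ^ 2 := by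
    gcongr
    exact Real.pi_lt_d6.le
  have hM' : (0 : ℝ) < M := by exact_mod_cast (by omega : 0 < M)
  refine ⟨K, eventually_kbar_lt (by omega) (by nlinarith), fun hcon => ?_⟩
  obtain ⟨N, hN, hN2⟩ := (hcon.and (eventually_ge_atTop 2)).exists
  have h1 := le_welchBound (N := N) (by omega : 0 < M) (by omega : M ≤ K) hN2
  have h2 := limitFactor_le_of_ratio_ge (M := M) (K := K) (by omega) (by omega)
  have h3 : (M : ℝ) * N * limitFactor M K ≤ (M : ℝ) * N * ((1 - (M : ℝ) / K) / 2) :=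
    mul_le_mul_of_nonneg_left h2 (by positivity)
  linarith

theorem eventually_welchBound_lt_of_mem {M : ℕ} (hM : 2 ≤ M) (h : M ∈ goodM) :
    ∀ᶠ N : ℕ in atTop, ∀ K : ℕ, Kbar M N + 1 ≤ K →
      welchBound M N K < (M : ℝ) * N * limitFactor M K := by
  have hs := goodM_spec M h
  set k := (149 * M + 59) / 60 - 1 with hk
  have hs' : (10000 : ℝ) * k < 24672 * M := by exact_mod_cast hs
  have hpi : 3.1415 ^ 2 ≤ Real.pi ^ 2 := by
    gcongr
    exact Real.pi_gt_d4.le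
  have hM' : (0 : ℝ) < M := by exact_mod_cast (by omega : 0 < M)
  exact eventually_welchBound_lt (k := k) (by omega) (by nlinarith) (by omega)

end QCSS

theorem theorem2 (M : ℕ) (hM : 2 ≤ M) :
    -- `f` is the limit of `Q(w, 0) / N` when `m ∼ rN`
    (∀ r : ℝ, 0 < r → r < 2 → ∀ m : ℕ → ℕ,
      Tendsto (fun N : ℕ => (m N : ℝ) / N) atTop (𝓝 r) →
      Tendsto (fun N : ℕ => QCSS.quadForm N (QCSS.sineWeight (m N)) 0 / N) atTop
        (𝓝 (QCSS.limitQ r))) ∧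
    -- the GLB of the weight vector, optimized over `m`, is asymptotically `M N (1 - inf …)`
    (∀ K : ℕ, 2 ≤ K →
      Tendsto (fun N : ℕ => QCSS.sineGLB M N K / ((M : ℝ) * N)) atTop
        (𝓝 (QCSS.limitFactor M K))) ∧
    -- the resulting asymptotic lower bound on the squared aperiodic tolerance
    (∀ K : ℕ, 1 ≤ K → ∀ ε : ℝ, 0 < ε → ∀ᶠ N : ℕ in atTop,
      ∀ C : Fin K → Matrix (Fin M) (Fin N) ℂ, QCSS.OverRootsOfUnity C →
        (M : ℝ) * N * (QCSS.limitFactor M K - ε) ≤ QCSS.deltaMax C ^ 2) ∧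
    -- the infimum is a minimum whenever `K ≥ Kbar + 1`
    (∀ K : ℕ, (∀ᶠ N : ℕ in atTop, QCSS.Kbar M N + 1 ≤ K) →
      ∃ r ∈ Set.Ioo (0 : ℝ) 2, IsMinOn (QCSS.limitLoss M K) (Set.Ioo 0 2) r) ∧
    -- comparison with the Welch bound, for each fixed `K ≥ Kbar + 1` as `N` tends to infinity
    ((∀ K : ℕ, (∀ᶠ N : ℕ in atTop, QCSS.Kbar M N + 1 ≤ K) →
        ∀ᶠ N : ℕ in atTop,
          QCSS.welchBound M N K < (M : ℝ) * N * QCSS.limitFactor M K) ↔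
      M ∈ QCSS.goodM) ∧
    -- comparison with the Welch bound, for all large `N` and simultaneously all `K ≥ Kbar + 1`
    ((∀ᶠ N : ℕ in atTop, ∀ K : ℕ, QCSS.Kbar M N + 1 ≤ K →
        QCSS.welchBound M N K < (M : ℝ) * N * QCSS.limitFactor M K) ↔
      M ∈ QCSS.goodM) := by
  have huniform : (∀ᶠ N : ℕ in atTop, ∀ K : ℕ, QCSS.Kbar M N + 1 ≤ K →
      QCSS.welchBound M N K < (M : ℝ) * N * QCSS.limitFactor M K) →
      ∀ K : ℕ, (∀ᶠ N : ℕ in atTop, QCSS.Kbar M N + 1 ≤ K) → ∀ᶠ N : ℕ in atTop,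
        QCSS.welchBound M N K < (M : ℝ) * N * QCSS.limitFactor M K := by
    intro h K hK
    filter_upwards [h, hK] with N h1 h2
    exact h1 K h2
  have hmem : (∀ K : ℕ, (∀ᶠ N : ℕ in atTop, QCSS.Kbar M N + 1 ≤ K) → ∀ᶠ N : ℕ in atTop,
      QCSS.welchBound M N K < (M : ℝ) * N * QCSS.limitFactor M K) → M ∈ QCSS.goodM := by
    intro h
    by_contra hcon
    obtain ⟨K, hK, hKn⟩ := QCSS.exists_not_welchBound_lt hM hcon
    exact hKn (h K hK)
  exact ⟨fun r h0 h2 m hm => QCSS.tendsto_quadForm_sineWeight h0 h2 hm,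
    fun K hK => QCSS.tendsto_sineGLB M K (by omega) hK,
    fun K hK ε hε => QCSS.eventually_le_deltaMax_sq M K (by omega) hK hε,
    fun K hK => QCSS.exists_isMinOn_limitLoss (by omega) (QCSS.le_of_eventually_kbar_lt hK),
    ⟨hmem, fun h => huniform (QCSS.eventually_welchBound_lt_of_mem hM h)⟩,
    ⟨fun h => hmem (huniform h), fun h => QCSS.eventually_welchBound_lt_of_mem hM h⟩⟩
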